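/- Let $M$ be a smooth $(2n+1)$-dimensional manifold with a contact distribution $\mathcal C$ (locally $\mathcal C=\ker\theta$ with $\theta$ a nowhere zero $1$-form and $d\theta|_{\mathcal C}$ non-degenerate), and let $\pi:M^{(1)}\to M$ be the bundle whose fibre over $m$ is the Lagrangian Grassmannian of the (conformally) symplectic space $(\mathcal C_m, d\theta|_{\mathcal C_m})$; a point $m^1\in M^{(1)}$ is a Lagrangian plane $L_{m^1}\subset\mathcal C_{\pi(m^1)}$. If $(e_i,e^j)$ is a local symplectic frame of $\mathcal C$, then $(m,\|p_{ij}\|)$, with $\|p_{ij}\|$ symmetric, are coordinates of the plane $\langle w_i\rangle$, $w_i=e_i+\sum_j p_{ij}e^j$. Let $\mathcal E\subset M^{(1)}$ be a second order PDE, i.e. a smooth embedded hypersurface, locally $\mathcal E=\{F=0\}$ with $dF\neq0$; its conformal metric at $m^1\in\mathcal E$ is the class, up to a non-zero factor, of $$(g_{\mathcal E})_{m^1}=\sum_{i\le j}\frac{\partial F}{\partial p_{ij}}\,w_i\vee w_j\in S^2(L_{m^1}),\qquad v\vee w=\tfrac12(v\otimes w+w\otimes v).$$ For an $n$-dimensional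 subspace $\mathcal D_m\subset\mathcal C_m$ given for each $m$, put $\mathcal E_{\mathcal D}=\{m^1\in M^{(1)} : L_{m^1}\cap\mathcal D_{\pi(m^1)}\neq0\}$. Suppose that: 1. for every $m^1\in\mathcal E$ the conformal metric is decomposable, $(g_{\mathcal E})_{m^1}=\ell_{m^1}\vee\ell'_{m^1}$ with lines $\ell_{m^1},\ell'_{m^1}\subset L_{m^1}$ (that is, it is the class of $v\vee v'$ with $\ell_{m^1}=\langle v\rangle$, $\ell'_{m^1}=\langle v'\rangle$, $v,v'\ne0$); 2. for every $m\in\pi(\mathcal E)$, when $m^1$ varies along the fibre $\mathcal E_m=\mathcal E\cap\pi^{-1}(m)$, the lines $\ell_{m^1}$ (respectively $\ell'_{m^1}$) fill, in the sense that they linearly span, an $n$-dimensional subspace $(\mathcal D_1)_m$ (respectively $(\mathcal D_2)_m$) of $\mathcal C_m$. Then every $m^1\in\mathcal E$ has an open neighbourhood $\mathcal O\subset M^{(1)}$ such that $$\mathcal E\cap\mathcal O=\mathcal E_{\mathcal D_1}\cap\mathcal O=\mathcal E_{\mathcal D_2}\cap\mathcal O .$$ If moreover the lines $\ell_{m^1}$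 (respectively $\ell'_{m^1}$) depend smoothly on $m^1\in\mathcal E$, then $\mathcal D_1$ (respectively $\mathcal D_2$) is a smooth $n$-dimensional subdistribution of $\mathcal C$ over the open set $\pi(\mathcal E)$. In particular, if $\ell$ or $\ell'$ is smooth, then $\mathcal E$ is a Monge-Ampère equation of Goursat type, i.e. it coincides locally with $\mathcal E_{\mathcal D}$ for a smooth $n$-dimensional subdistribution $\mathcal D\subset\mathcal C$. -/

import Mathlib

open scoped Manifold ContDiff TensorProduct

noncomputable section

namespace ContactPDE

section Contact

variable {n : ℕ} {M : Type*} [TopologicalSpace M]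
  [ChartedSpace (EuclideanSpace ℝ (Fin (2 * n + 1))) M]

/-- The expression of a `1`-form `θ` in the chart around `m₀`, that is, the pull-back of `θ` by
the inverse of that chart. -/
def localExpr (θ : (m : M) → TangentSpace (𝓡 (2 * n + 1)) m →L[ℝ] ℝ) (m₀ : M)
    (y : EuclideanSpace ℝ (Fin (2 * n + 1))) : EuclideanSpace ℝ (Fin (2 * n + 1)) →L[ℝ] ℝ :=
  (θ ((extChartAt (𝓡 (2 * n + 1)) m₀).symm y)).comp
    (mfderiv 𝓘(ℝ, EuclideanSpace ℝ (Fin (2 * n + 1))) (𝓡 (2 * n + 1))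
      (extChartAt (𝓡 (2 * n + 1)) m₀).symm y)

/-- Smoothness of a `1`-form on `U`: its expressions in charts are smooth. -/
def IsSmoothOneFormOn (θ : (m : M) → TangentSpace (𝓡 (2 * n + 1)) m →L[ℝ] ℝ) (U : Set M) : Prop :=
  ∀ m₀ : M, ContDiffOn ℝ ∞ (localExpr θ m₀)
    ((extChartAt (𝓡 (2 * n + 1)) m₀).target ∩ (extChartAt (𝓡 (2 * n + 1)) m₀).symm ⁻¹' U)

/-- The exterior derivative `dθ` of a `1`-form at `m`, computed in the chart around `m`:
`dθ (v, w) = (D_v θ) w - (D_w θ) v`. -/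
def dForm (θ : (m : M) → TangentSpace (𝓡 (2 * n + 1)) m →L[ℝ] ℝ) (m : M) :
    TangentSpace (𝓡 (2 * n + 1)) m →ₗ[ℝ] TangentSpace (𝓡 (2 * n + 1)) m →ₗ[ℝ] ℝ :=
  let φ := extChartAt (𝓡 (2 * n + 1)) m
  let A : TangentSpace (𝓡 (2 * n + 1)) m →L[ℝ] EuclideanSpace ℝ (Fin (2 * n + 1)) :=
    mfderiv (𝓡 (2 * n + 1)) 𝓘(ℝ, EuclideanSpace ℝ (Fin (2 * n + 1))) φ m
  LinearMap.mk₂ ℝ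
    (fun v w => fderiv ℝ (localExpr θ m) (φ m) (A v) (A w)
      - fderiv ℝ (localExpr θ m) (φ m) (A w) (A v))
    (fun v v' w => by simp only [map_add, add_apply]; ring)
    (fun c v w => by
      simp only [map_smul, smul_apply, smul_eq_mul]; ring)
    (fun v w w' => by simp only [map_add, add_apply]; ring)
    (fun c v w => by
      simp only [map_smul, smul_apply, smul_eq_mul]; ring)

lemma dForm_swap (θ : (m : M) → TangentSpace (𝓡 (2 * n + 1)) m →L[ℝ] ℝ) (m : M)
    (v w : TangentSpace (𝓡 (2 * n + 1)) m) : dForm θ m v w = - dForm θ m w v := by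
  simp [dForm]

variable [IsManifold (𝓡 (2 * n + 1)) ∞ M]

/-- Smoothness of a vector field on `U`. -/
def IsSmoothFieldOn (X : (m : M) → TangentSpace (𝓡 (2 * n + 1)) m) (U : Set M) : Prop :=
  ContMDiffOn (𝓡 (2 * n + 1)) (𝓡 (2 * n + 1)).tangent ∞
    (fun m => (⟨m, X m⟩ : TangentBundle (𝓡 (2 * n + 1)) M)) U

/-- `θ` is a contact form on the open set `U` with kernel the distribution `C`: it is smooth, nowhere
zero, `C = ker θ`, and `dθ` is non-degenerate on `C`. -/
structure IsContactFormOn (C : (m : M) → Submodule ℝ (TangentSpace (𝓡 (2 * n + 1)) m))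
    (θ : (m : M) → TangentSpace (𝓡 (2 * n + 1)) m →L[ℝ] ℝ) (U : Set M) : Prop where
  isOpen : IsOpen U
  smooth : IsSmoothOneFormOn θ U
  ne_zero : ∀ m ∈ U, θ m ≠ 0
  mem_iff : ∀ m ∈ U, ∀ v, v ∈ C m ↔ θ m v = 0
  nondegenerate : ∀ m ∈ U, ∀ v ∈ C m, (∀ w ∈ C m, dForm θ m v w = 0) → v = 0

/-- `C` is a contact distribution on the `(2n+1)`-dimensional manifold `M`: a completely
non-integrable distribution of codimension one. -/
def IsContactStructure (C : (m : M) → Submodule ℝ (TangentSpace (𝓡 (2 * n + 1)) m)) : Prop :=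
  ∀ m : M, ∃ (U : Set M) (θ : (m : M) → TangentSpace (𝓡 (2 * n + 1)) m →L[ℝ] ℝ),
    m ∈ U ∧ IsContactFormOn C θ U

/-- A subspace of `C_m` is isotropic if `dθ` vanishes on it, `θ` being a contact form near `m`
(`dθ|_C` is multiplied by a non-zero function when another contact form is chosen). -/
def IsIsotropic (C : (m : M) → Submodule ℝ (TangentSpace (𝓡 (2 * n + 1)) m)) (m : M)
    (L : Submodule ℝ (TangentSpace (𝓡 (2 * n + 1)) m)) : Prop :=
  L ≤ C m ∧ ∃ (U : Set M) (θ : (m : M) → TangentSpace (𝓡 (2 * n + 1)) m →L[ℝ] ℝ),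
    m ∈ U ∧ IsContactFormOn C θ U ∧ ∀ v ∈ L, ∀ w ∈ L, dForm θ m v w = 0

/-- The prolongation `M⁽¹⁾` of `(M, C)`: its points are the Lagrangian planes of the contact
distribution. -/
@[ext]
structure Prolongation (C : (m : M) → Submodule ℝ (TangentSpace (𝓡 (2 * n + 1)) m)) where
  base : M
  plane : Submodule ℝ (TangentSpace (𝓡 (2 * n + 1)) base)
  isotropic : IsIsotropic C base plane
  finrank_eq : Module.finrank ℝ plane = n

/-- A local symplectic frame `e_i, e^j` (here `e i`, `f j`) of the contact distribution, over the
open domain `dom` of a contact form `θ`. -/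
structure SymplecticFrame (C : (m : M) → Submodule ℝ (TangentSpace (𝓡 (2 * n + 1)) m)) where
  dom : Set M
  θ : (m : M) → TangentSpace (𝓡 (2 * n + 1)) m →L[ℝ] ℝ
  contactForm : IsContactFormOn C θ dom
  e : Fin n → (m : M) → TangentSpace (𝓡 (2 * n + 1)) m
  f : Fin n → (m : M) → TangentSpace (𝓡 (2 * n + 1)) m
  smooth_e : ∀ i, IsSmoothFieldOn (e i) dom
  smooth_f : ∀ i, IsSmoothFieldOn (f i) dom
  e_mem : ∀ i, ∀ m ∈ dom, e i m ∈ C m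
  f_mem : ∀ i, ∀ m ∈ dom, f i m ∈ C m
  e_e : ∀ i j, ∀ m ∈ dom, dForm θ m (e i m) (e j m) = 0
  f_f : ∀ i j, ∀ m ∈ dom, dForm θ m (f i m) (f j m) = 0
  e_f : ∀ i j, ∀ m ∈ dom, dForm θ m (e i m) (f j m) = if i = j then 1 else 0

variable {C : (m : M) → Submodule ℝ (TangentSpace (𝓡 (2 * n + 1)) m)}

namespace SymplecticFrame

/-- The vector `w_i = e_i + p_{ij} e^j` at `m`; a symmetric matrix `‖p_{ij}‖` is a function on the
unordered pairs of indices. -/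
def w (Φ : SymplecticFrame C) (m : M) (p : Sym2 (Fin n) → ℝ) (i : Fin n) :
    TangentSpace (𝓡 (2 * n + 1)) m :=
  Φ.e i m + ∑ j, p s(i, j) • Φ.f j m

lemma dForm_w_f (Φ : SymplecticFrame C) {m : M} (hm : m ∈ Φ.dom) (p : Sym2 (Fin n) → ℝ)
    (i k : Fin n) : dForm Φ.θ m (Φ.w m p i) (Φ.f k m) = if i = k then 1 else 0 := by
  simp [w, Φ.e_f i k m hm, Φ.f_f _ k m hm]

lemma dForm_w_w (Φ : SymplecticFrame C) {m : M} (hm : m ∈ Φ.dom) (p : Sym2 (Fin n) → ℝ)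
    (i k : Fin n) : dForm Φ.θ m (Φ.w m p i) (Φ.w m p k) = 0 := by
  have h : ∀ j, dForm Φ.θ m (Φ.f j m) (Φ.e k m) = -(if k = j then 1 else 0) := fun j => by
    rw [dForm_swap, Φ.e_f k j m hm]
  simp [w, Φ.e_e i k m hm, Φ.f_f _ _ m hm, Φ.e_f _ _ m hm, h, Sym2.eq_swap (a := k) (b := i)]

lemma linearIndependent_w (Φ : SymplecticFrame C) {m : M} (hm : m ∈ Φ.dom)
    (p : Sym2 (Fin n) → ℝ) : LinearIndependent ℝ (Φ.w m p) := by
  rw [Fintype.linearIndependent_iff]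
  intro c hc k
  have h := congrArg (fun v => dForm Φ.θ m v (Φ.f k m)) hc
  simpa [Φ.dForm_w_f hm] using h

/-- The Lagrangian plane `L_P = ⟨e_i + p_{ij} e^j⟩` of `C_m`. The maps `(m, p) ↦ L_P` are the inverses
of the standard charts of `M⁽¹⁾`. -/
def point (Φ : SymplecticFrame C) (m : M) (hm : m ∈ Φ.dom) (p : Sym2 (Fin n) → ℝ) :
    Prolongation C where
  base := m
  plane := Submodule.span ℝ (Set.range (Φ.w m p))
  isotropic := by
    refine ⟨?_, Φ.dom, Φ.θ, hm, Φ.contactForm, ?_⟩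
    · rw [Submodule.span_le]
      rintro _ ⟨i, rfl⟩
      exact add_mem (Φ.e_mem i m hm)
        (sum_mem fun j _ => Submodule.smul_mem _ _ (Φ.f_mem j m hm))
    · intro v hv u hu
      induction hv, hu using Submodule.span_induction₂ with
      | mem_mem x y hx hy =>
        obtain ⟨i, rfl⟩ := hx
        obtain ⟨k, rfl⟩ := hy
        exact Φ.dForm_w_w hm p i k
      | zero_left y hy => simp
      | zero_right x hx => simp
      | add_left x y z _ _ _ h1 h2 => simp [h1, h2]
      | add_right x y z _ _ _ h1 h2 => simp [h1, h2]
      | smul_left r x y _ _ h => simp [h]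
      | smul_right r x y _ _ h => simp [h]
  finrank_eq := by
    rw [finrank_span_eq_card (Φ.linearIndependent_w hm p), Fintype.card_fin]

end SymplecticFrame

/-- The topology of `M⁽¹⁾`: a set is open iff it is open in all the standard charts. -/
instance : TopologicalSpace (Prolongation C) where
  IsOpen O := ∀ Φ : SymplecticFrame C,
    IsOpen {q : M × (Sym2 (Fin n) → ℝ) | ∃ h : q.1 ∈ Φ.dom, Φ.point q.1 h q.2 ∈ O}
  isOpen_univ Φ := by
    simp only [Set.mem_univ, exists_prop, and_true]
    exact Φ.contactForm.isOpen.preimage continuous_fst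
  isOpen_inter s t hs ht Φ := by
    convert (hs Φ).inter (ht Φ) using 1
    ext q
    simp only [Set.mem_inter_iff, Set.mem_ofPred_eq]
    exact ⟨fun ⟨h, h1, h2⟩ => ⟨⟨h, h1⟩, ⟨h, h2⟩⟩, fun ⟨⟨h, h1⟩, ⟨_, h2⟩⟩ => ⟨h, h1, h2⟩⟩
  isOpen_sUnion S hS Φ := by
    convert isOpen_biUnion fun s (hs : s ∈ S) => hS s hs Φ using 1
    ext q
    simp only [Set.mem_sUnion, Set.mem_ofPred_eq, Set.mem_iUnion]
    exact ⟨fun ⟨h, s, hs, hq⟩ => ⟨s, hs, h, hq⟩, fun ⟨s, hs, h, hq⟩ => ⟨h, s, hs, hq⟩⟩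

/-- In the chart of `M⁽¹⁾` given by the frame `Φ`, the set `E` is given on the open set `W` by the
equation `F = 0`, where `F` is smooth and `dF ≠ 0` at the points of `E`. -/
structure IsLocalEquation (Φ : SymplecticFrame C) (E : Set (Prolongation C))
    (W : Set (M × (Sym2 (Fin n) → ℝ))) (F : M × (Sym2 (Fin n) → ℝ) → ℝ) : Prop where
  isOpen : IsOpen W
  mem_dom : ∀ q ∈ W, q.1 ∈ Φ.dom
  smooth : ContMDiffOn ((𝓡 (2 * n + 1)).prod 𝓘(ℝ, Sym2 (Fin n) → ℝ)) 𝓘(ℝ, ℝ) ∞ F W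
  mem_iff : ∀ q, ∀ hq : q ∈ W, Φ.point q.1 (mem_dom q hq) q.2 ∈ E ↔ F q = 0
  nonsingular : ∀ q ∈ W, F q = 0 →
    mfderiv ((𝓡 (2 * n + 1)).prod 𝓘(ℝ, Sym2 (Fin n) → ℝ)) 𝓘(ℝ, ℝ) F q ≠ 0

/-- A (smooth, embedded) hypersurface of `M⁽¹⁾`, that is, a scalar second order PDE with one
unknown function and `n` independent variables. -/
def IsHypersurface (E : Set (Prolongation C)) : Prop :=
  ∀ x ∈ E, ∃ (Φ : SymplecticFrame C) (W : Set (M × (Sym2 (Fin n) → ℝ)))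
    (F : M × (Sym2 (Fin n) → ℝ) → ℝ) (h : x.base ∈ Φ.dom) (p : Sym2 (Fin n) → ℝ),
    IsLocalEquation Φ E W F ∧ (x.base, p) ∈ W ∧ Φ.point x.base h p = x

/-- The symmetric product `v ∨ w = (v ⊗ w + w ⊗ v) / 2`. -/
def symProd {V : Type*} [AddCommGroup V] [Module ℝ V] (v w : V) : V ⊗[ℝ] V :=
  (1 / 2 : ℝ) • (v ⊗ₜ[ℝ] w + w ⊗ₜ[ℝ] v)

lemma symProd_comm {V : Type*} [AddCommGroup V] [Module ℝ V] (v w : V) :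
    symProd v w = symProd w v := by
  simp [symProd, add_comm]

/-- The contravariant metric `g_{dF} = ∑_{i ≤ j} (∂F/∂p_{ij}) w_i ∨ w_j` on the Lagrangian plane
with coordinates `(m, p)`. Up to a non-zero factor it depends only on the hypersurface `F = 0`, and
its class is the conformal metric of that hypersurface. -/
def SymplecticFrame.metric (Φ : SymplecticFrame C) (F : M × (Sym2 (Fin n) → ℝ) → ℝ) (m : M)
    (p : Sym2 (Fin n) → ℝ) :
    TangentSpace (𝓡 (2 * n + 1)) m ⊗[ℝ] TangentSpace (𝓡 (2 * n + 1)) m :=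
  ∑ s : Sym2 (Fin n), fderiv ℝ (fun p' => F (m, p')) p (Pi.single s 1) •
    Sym2.lift ⟨fun i j => symProd (Φ.w m p i) (Φ.w m p j), fun _ _ => symProd_comm _ _⟩ s

/-- The conformal metric of `E` at `x` is decomposable, `(g_E)_x = ℓ ∨ ℓ'` with lines `ℓ, ℓ'`
of the Lagrangian plane `x`. -/
def MetricDecomposes (E : Set (Prolongation C)) (x : Prolongation C)
    (ℓ ℓ' : Submodule ℝ (TangentSpace (𝓡 (2 * n + 1)) x.base)) : Prop :=
  ∃ v ∈ x.plane, ∃ v' ∈ x.plane, v ≠ 0 ∧ v' ≠ 0 ∧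
    ℓ = Submodule.span ℝ {v} ∧ ℓ' = Submodule.span ℝ {v'} ∧
    ∃ (Φ : SymplecticFrame C) (W : Set (M × (Sym2 (Fin n) → ℝ)))
      (F : M × (Sym2 (Fin n) → ℝ) → ℝ) (h : x.base ∈ Φ.dom) (p : Sym2 (Fin n) → ℝ),
      IsLocalEquation Φ E W F ∧ (x.base, p) ∈ W ∧ Φ.point x.base h p = x ∧
        Φ.metric F x.base p = symProd v v'

/-- Along each fibre `E_m` of `E`, the lines `ℓ` fill the `n`-dimensional space `D_m`: `D_m` is
`n`-dimensional and is the linear span of the lines `ℓ_x`, `x ∈ E_m`. -/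
def Fill (E : Set (Prolongation C))
    (ℓ : (x : Prolongation C) → Submodule ℝ (TangentSpace (𝓡 (2 * n + 1)) x.base))
    (D : (m : M) → Submodule ℝ (TangentSpace (𝓡 (2 * n + 1)) m)) : Prop :=
  ∀ m : M, (∃ x ∈ E, x.base = m) →
    Module.finrank ℝ (D m) = n ∧
    D m = Submodule.span ℝ {v | ∃ x ∈ E, ∃ u ∈ ℓ x,
      (⟨m, v⟩ : TangentBundle (𝓡 (2 * n + 1)) M) = ⟨x.base, u⟩}

/-- The equation `E_D`: the Lagrangian planes which meet `D` non-trivially. -/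
def equationOf (C D : (m : M) → Submodule ℝ (TangentSpace (𝓡 (2 * n + 1)) m)) :
    Set (Prolongation C) :=
  {x | x.plane ⊓ D x.base ≠ ⊥}

/-- `D` is, over `U`, a smooth `n`-dimensional subdistribution of `C` (in particular `U` is open). -/
def IsSubdistributionOn (C D : (m : M) → Submodule ℝ (TangentSpace (𝓡 (2 * n + 1)) m))
    (U : Set M) : Prop :=
  ∀ m ∈ U, ∃ V : Set M, IsOpen V ∧ m ∈ V ∧ V ⊆ U ∧
    ∃ X : Fin n → (m : M) → TangentSpace (𝓡 (2 * n + 1)) m,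
      (∀ i, IsSmoothFieldOn (X i) V) ∧
      ∀ m' ∈ V, LinearIndependent ℝ (fun i => X i m') ∧
        D m' = Submodule.span ℝ (Set.range fun i => X i m') ∧ D m' ≤ C m'

/-- The lines `ℓ_x ⊂ L_x`, `x ∈ E`, depend smoothly on `x`: near each point of `E` they are spanned
by a vector `c^i w_i` with smooth coefficients. -/
def IsSmoothLineField (E : Set (Prolongation C))
    (ℓ : (x : Prolongation C) → Submodule ℝ (TangentSpace (𝓡 (2 * n + 1)) x.base)) : Prop :=
  ∀ x ∈ E, ∃ (Φ : SymplecticFrame C) (W : Set (M × (Sym2 (Fin n) → ℝ)))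
    (c : Fin n → M × (Sym2 (Fin n) → ℝ) → ℝ) (h : x.base ∈ Φ.dom) (p : Sym2 (Fin n) → ℝ),
    IsOpen W ∧ (x.base, p) ∈ W ∧ Φ.point x.base h p = x ∧
    (∀ i, ContMDiffOn ((𝓡 (2 * n + 1)).prod 𝓘(ℝ, Sym2 (Fin n) → ℝ)) 𝓘(ℝ, ℝ) ∞ (c i) W) ∧
    ∀ q ∈ W, ∀ hq : q.1 ∈ Φ.dom, Φ.point q.1 hq q.2 ∈ E →
      (∃ i, c i q ≠ 0) ∧
      ℓ (Φ.point q.1 hq q.2) = Submodule.span ℝ {∑ i, c i q • Φ.w q.1 q.2 i}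

/-- `E` is a Monge-Ampère equation of Goursat type: locally `E = E_D` for a smooth `n`-dimensional
subdistribution `D` of `C`. -/
def IsGoursatType (E : Set (Prolongation C)) : Prop :=
  ∀ x ∈ E, ∃ (D : (m : M) → Submodule ℝ (TangentSpace (𝓡 (2 * n + 1)) m)) (U : Set M)
    (O : Set (Prolongation C)), IsSubdistributionOn C D U ∧ IsOpen O ∧ x ∈ O ∧
      (∀ y ∈ O, y.base ∈ U) ∧ E ∩ O = equationOf C D ∩ O

end Contact

end ContactPDE

end

noncomputable section

namespace ContactPDE

open Filter
open scoped Topology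

/-! ### Symmetric bilinear forms degenerating on a pair of subspaces. -/

section Algebra

variable {V : Type*} [AddCommGroup V] [Module ℝ V]

open Module

/-! One inclusion is immediate: the line `ℓ x` lies both in the plane `x` and in `D`, so `E` is
contained in `E_D`. The work is the converse near a point of `E`, where `D` is not known to be even
continuous.

In a chart `(m, P)` let the rows of `(A | B)` be the coefficients of a basis of `D_m`. A vector with
coefficients `(yA, yB)` lies in `L_P` iff `yB = yAP`, so `E_D` is the set `det (B - AP) = 0`
(`exists_matrices`). Taking the rows orthonormal keeps `A` and `B` in a compact set, and compactness
replaces continuity. If points outside `E` with vanishing determinant accumulated at `(x₀, P₀)`, an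
ultrafilter of such points would give limits `A₀`, `B₀`. Put `N = B₀ - A₀P₀`, let `K` be the image
under `A₀` of the left kernel of `N`, and `K'` the right kernel; they have the same dimension.

Every direction `h` tangent to the fibre of `E` is approximated by secants from `P₀` to zeros of
`F`, found by sign changes that persist for nearby base points. The determinants vanish at these
zeros, and in the limit `h` degenerates on `K × K'` (`degenerate_of_limit`). By decomposability the
tangent directions are exactly the symmetric `h` with `h(c, c') = 0`, where `c`, `c'` are nonzero.
This hyperplane contains forms that are nondegenerate on `K × K'` when the dimension is at least 2.
So `K` and `K'` are at most lines, and on nonzero vectors of them `h(r, u)` is a nonzero multiple of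
`h(c, c')` (`apply_ne_zero_of_degenerate`).

On the other hand, from a bad point a small nonzero displacement in a transversal direction `g`
reaches `E`. Both ends have vanishing determinant, so the limit yields `r` and `u` nonzero with
`g(r, u) = 0`, while `g(c, c') = 1`. This contradiction is `eventually_eq_zero_of_det`.

For smoothness, choose vectors of lines `ℓ` over `m₀` forming a basis of `D` there. Each extends
along a local section of `E`, given by the implicit function theorem, to a smooth field with values
in `ℓ ⊆ D` (`Fill.exists_field`). These fields stay independent near `m₀`, and since `D` has
dimension `n` they span it. -/

lemma exists_notMem_of_ne_top (s : List (Subspace ℝ V)) (hs : ∀ p ∈ s, p ≠ ⊤) :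
    ∃ x, ∀ p ∈ s, x ∉ p := by
  classical
  have h := Subspace.biUnion_ne_univ_of_top_notMem (s := s.toFinset)
    (fun h => hs ⊤ (List.mem_toFinset.1 h) rfl)
  rw [Set.ne_univ_iff_exists_notMem] at h
  obtain ⟨x, hx⟩ := h
  simp only [Set.mem_iUnion, List.mem_toFinset] at hx
  exact ⟨x, fun p hp hxp => hx ⟨p, hp, hxp⟩⟩

/-- Restriction of forms to `K` is onto the dual of `K`, which `j < finrank ℝ K` forms cannot span.
-/
lemma comap_dualRestrict_ne_top (K : Subspace ℝ V) {j : ℕ} (hj : j < finrank ℝ K)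
    (ξ : Fin j → Dual ℝ V) :
    (Submodule.span ℝ (Set.range fun i => K.dualRestrict (ξ i))).comap K.dualRestrict ≠ ⊤ := by
  intro h
  have h1 : Submodule.span ℝ (Set.range fun i => K.dualRestrict (ξ i)) = ⊤ := by
    rw [eq_top_iff]
    intro x _
    obtain ⟨y, rfl⟩ := Subspace.dualRestrict_surjective (W := K) x
    have : y ∈ (⊤ : Submodule ℝ (Dual ℝ V)) := trivial
    rw [← h] at this
    exact this
  have h2 := finrank_range_le_card (R := ℝ) (fun i => K.dualRestrict (ξ i))
  rw [Set.finrank, h1, finrank_top, Subspace.dual_finrank_eq, Fintype.card_fin] at h2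
  omega

variable [FiniteDimensional ℝ V]

lemma ker_eval_ne_top {c : V} (hc : c ≠ 0) : LinearMap.ker (Dual.eval ℝ V c) ≠ ⊤ := by
  intro h
  apply hc
  rw [LinearMap.ker_eq_top] at h
  exact (forall_dual_apply_eq_zero_iff ℝ c).1 fun φ => by
    simpa using congrArg (fun l => l φ) h

/-- Linear forms in general position with respect to two subspaces and two vectors. -/
lemma exists_generic_forms (K K' : Subspace ℝ V) {c c' : V} (hc : c ≠ 0) (hc' : c' ≠ 0) (j : ℕ)
    (hj : j ≤ finrank ℝ K) (hj' : j ≤ finrank ℝ K') :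
    ∃ ξ : Fin j → Dual ℝ V, LinearIndependent ℝ (fun i => K.dualRestrict (ξ i)) ∧
      LinearIndependent ℝ (fun i => K'.dualRestrict (ξ i)) ∧ ∀ i, ξ i c ≠ 0 ∧ ξ i c' ≠ 0 := by
  induction j with
  | zero => exact ⟨Fin.elim0, linearIndependent_empty_type, linearIndependent_empty_type,
      fun i => i.elim0⟩
  | succ j ih =>
    obtain ⟨ξ, h1, h2, h3⟩ := ih (by omega) (by omega)
    -- A real vector space is not a finite union of proper subspaces. Two of those avoided here
    -- preserve independence on `K` and `K'`; the other two consist of the forms killing `c` or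
    -- `c'`.
    obtain ⟨η, hη⟩ := exists_notMem_of_ne_top
      [(Submodule.span ℝ (Set.range fun i => K.dualRestrict (ξ i))).comap K.dualRestrict,
       (Submodule.span ℝ (Set.range fun i => K'.dualRestrict (ξ i))).comap K'.dualRestrict,
       LinearMap.ker (Dual.eval ℝ V c), LinearMap.ker (Dual.eval ℝ V c')] (by
        simp only [List.mem_cons, List.not_mem_nil, or_false, forall_eq_or_imp, forall_eq]
        exact ⟨comap_dualRestrict_ne_top K (by omega) ξ, comap_dualRestrict_ne_top K' (by omega) ξ,
          ker_eval_ne_top hc, ker_eval_ne_top hc'⟩)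
    simp only [List.mem_cons, List.not_mem_nil, or_false, forall_eq_or_imp, forall_eq,
      Submodule.mem_comap, LinearMap.mem_ker, Dual.eval_apply] at hη
    have key : ∀ L : Subspace ℝ V, (fun i => L.dualRestrict ((Fin.snoc ξ η : Fin (j + 1) → _) i))
        = Fin.snoc (fun i => L.dualRestrict (ξ i)) (L.dualRestrict η) := by
      intro L
      funext i
      refine Fin.lastCases ?_ (fun i => ?_) i <;> simp
    refine ⟨Fin.snoc ξ η, ?_, ?_, ?_⟩
    · rw [key, linearIndependent_finSnoc]
      exact ⟨h1, hη.1⟩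
    · rw [key, linearIndependent_finSnoc]
      exact ⟨h2, hη.2.1⟩
    · intro i
      refine Fin.lastCases ?_ (fun i => ?_) i
      · simpa using hη.2.2
      · simpa using h3 i

lemma exists_coeffs_ne_zero {k : ℕ} (hk : 2 ≤ k) (d : Fin k → ℝ) (hd : ∀ i, d i ≠ 0) :
    ∃ l : Fin k → ℝ, (∀ i, l i ≠ 0) ∧ ∑ i, l i * d i = 0 := by
  obtain ⟨m, rfl⟩ : ∃ m, k = m + 2 := ⟨k - 2, by omega⟩
  -- The `m + 1` indices other than `0` contribute `1` each to the sum, and the index `0` cancels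
  -- them.
  refine ⟨fun i => (if i = 0 then -((m : ℝ) + 1) else 1) / d i, fun i => ?_, ?_⟩
  · refine div_ne_zero ?_ (hd i)
    split_ifs
    · have : (0 : ℝ) ≤ m := m.cast_nonneg
      intro h
      linarith
    · exact one_ne_zero
  · simp_rw [div_mul_cancel₀ _ (hd _)]
    rw [Fin.sum_univ_succ]
    simp [Fin.succ_ne_zero]

/-- Take `h = ∑ lᵢ ξᵢ ⊗ ξᵢ` with generic `ξᵢ`, as many as the common dimension, and nonzero weights
making `h c c'` vanish; such weights need at least two terms. If `u` is orthogonal to `K`,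
independence of the `ξᵢ` on `K` gives `ξᵢ u = 0`, and the `ξᵢ` span the dual of `K'`. -/
lemma exists_symm_nondegenerate (K K' : Subspace ℝ V) (hK : finrank ℝ K = finrank ℝ K')
    (hk : 2 ≤ finrank ℝ K) {c c' : V} (hc : c ≠ 0) (hc' : c' ≠ 0) :
    ∃ h : V →ₗ[ℝ] V →ₗ[ℝ] ℝ, (∀ a b, h a b = h b a) ∧ h c c' = 0 ∧
      ∀ u ∈ K', (∀ r ∈ K, h r u = 0) → u = 0 := by
  obtain ⟨ξ, h1, h2, h3⟩ := exists_generic_forms K K' hc hc' _ le_rfl hK.le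
  obtain ⟨l, hl, hl0⟩ := exists_coeffs_ne_zero hk (fun i => ξ i c * ξ i c')
    (fun i => mul_ne_zero (h3 i).1 (h3 i).2)
  have hval : ∀ a b, (∑ i, l i • (ξ i).smulRight (ξ i) : V →ₗ[ℝ] V →ₗ[ℝ] ℝ) a b
      = ∑ i, l i * (ξ i a * ξ i b) := by
    intro a b
    simp [LinearMap.sum_apply]
  refine ⟨∑ i, l i • (ξ i).smulRight (ξ i), fun a b => ?_, ?_, ?_⟩
  · rw [hval, hval]
    exact Finset.sum_congr rfl fun i _ => by ring
  · rw [hval, hl0]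
  · intro u hu hr
    rw [Fintype.linearIndependent_iff] at h1
    have hz : ∀ i, l i * ξ i u = 0 := h1 _ <| by
      ext r
      have := hr r r.2
      rw [hval] at this
      simp only [LinearMap.sum_apply, LinearMap.smul_apply, Submodule.dualRestrict_apply,
        smul_eq_mul, LinearMap.zero_apply]
      rw [← this]
      exact Finset.sum_congr rfl fun i _ => by ring
    have hz' : ∀ i, ξ i u = 0 := fun i => (mul_eq_zero.1 (hz i)).resolve_left (hl i)
    have hspan : Submodule.span ℝ (Set.range fun i => K'.dualRestrict (ξ i)) = ⊤ :=
      h2.span_eq_top_of_card_eq_finrank' (by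
        rw [Fintype.card_fin, Subspace.dual_finrank_eq, hK])
    have : (⟨u, hu⟩ : K') = 0 := by
      rw [← forall_dual_apply_eq_zero_iff ℝ]
      intro φ
      have hφ : φ ∈ Submodule.span ℝ (Set.range fun i => K'.dualRestrict (ξ i)) := by
        rw [hspan]; trivial
      induction hφ using Submodule.span_induction with
      | mem x hx => obtain ⟨i, rfl⟩ := hx; simpa using hz' i
      | zero => simp
      | add x y _ _ hx hy => simp [hx, hy]
      | smul a x _ hx => simp [hx]
    simpa using this

lemma exists_form_ne_zero {a b : V} (ha : a ≠ 0) (hb : b ≠ 0) : ∃ ξ : Dual ℝ V, ξ a ≠ 0 ∧ ξ b ≠ 0 := by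
  obtain ⟨ξ, h⟩ := exists_notMem_of_ne_top
    [LinearMap.ker (Dual.eval ℝ V a), LinearMap.ker (Dual.eval ℝ V b)] (by
      simp only [List.mem_cons, List.not_mem_nil, or_false, forall_eq_or_imp, forall_eq]
      exact ⟨ker_eval_ne_top ha, ker_eval_ne_top hb⟩)
  simp only [List.mem_cons, List.not_mem_nil, or_false, forall_eq_or_imp, forall_eq,
      LinearMap.mem_ker, Dual.eval_apply] at h
  exact ⟨ξ, h⟩

/-- If all symmetric forms in the hyperplane `h (c, c') = 0` degenerate on `K × K'`, then `K` and
`K'` are lines with `K ∨ K' = c ∨ c'`. -/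
lemma apply_ne_zero_of_degenerate (K K' : Subspace ℝ V) (hK : finrank ℝ K = finrank ℝ K')
    {c c' : V} (hc : c ≠ 0) (hc' : c' ≠ 0)
    (H : ∀ h : V →ₗ[ℝ] V →ₗ[ℝ] ℝ, (∀ a b, h a b = h b a) → h c c' = 0 →
      ∃ u ∈ K', u ≠ 0 ∧ ∀ r ∈ K, h r u = 0)
    {r u : V} (hr : r ∈ K) (hr0 : r ≠ 0) (hu : u ∈ K') (hu0 : u ≠ 0)
    (h : V →ₗ[ℝ] V →ₗ[ℝ] ℝ) (hs : ∀ a b, h a b = h b a) (hcc : h c c' ≠ 0) : h r u ≠ 0 := by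
  have hk1 : finrank ℝ K ≤ 1 := by
    by_contra hk
    obtain ⟨h, h1, h2, h3⟩ := exists_symm_nondegenerate K K' hK (by omega) hc hc'
    obtain ⟨u, hu, hu0, hur⟩ := H h h1 h2
    exact hu0 (h3 u hu hur)
  have hprop : ∀ u' ∈ K', ∃ t : ℝ, t • u = u' := by
    rw [hK] at hk1
    have h1 := finrank_le_one_iff.1 hk1
    obtain ⟨v, hv⟩ := h1
    intro u' hu'
    obtain ⟨t, ht⟩ := hv ⟨u, hu⟩
    obtain ⟨t', ht'⟩ := hv ⟨u', hu'⟩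
    have e1 : t • (v : V) = u := congrArg Subtype.val ht
    have e2 : t' • (v : V) = u' := congrArg Subtype.val ht'
    have ht0 : t ≠ 0 := fun h0 => hu0 (by rw [← e1, h0, zero_smul])
    exact ⟨t' / t, by rw [← e1, ← e2, smul_smul, div_mul_cancel₀ _ ht0]⟩
  -- As `K'` is a line, the degenerate vector supplied by `H`, which depends on `h`, is a multiple
  -- of the fixed `u`.
  have H' : ∀ h : V →ₗ[ℝ] V →ₗ[ℝ] ℝ, (∀ a b, h a b = h b a) → h c c' = 0 → h r u = 0 := by
    intro h hs hc0
    obtain ⟨u', hu', hu0', hh⟩ := H h hs hc0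
    obtain ⟨t, rfl⟩ := hprop u' hu'
    have := hh r hr
    rw [map_smul, smul_eq_mul, mul_eq_zero] at this
    exact this.resolve_left fun h0 => hu0' (by rw [h0, zero_smul])
  intro h0
  obtain ⟨ξ, hξr, hξu⟩ := exists_form_ne_zero hr0 hu0
  -- Subtracting a multiple of `h` brings `ξ ⊗ ξ` into the hyperplane `h (c, c') = 0`. If `h r u`
  -- vanished, so would `ξ r * ξ u`.
  have := H' (ξ.smulRight ξ - (ξ c * ξ c' / h c c') • h)
    (fun a b => by simp [hs a b]; ring) (by simp [hcc])
  simp only [LinearMap.sub_apply, LinearMap.smulRight_apply, LinearMap.smul_apply, smul_eq_mul,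
    h0, mul_zero, sub_zero] at this
  exact mul_ne_zero hξr hξu this

end Algebra

/-! ### Symmetric matrices and the two kernels of `B - A P`. -/

section SymmetricMatrices

open Module

variable {n : ℕ}

/-- The symmetric matrix with entries `p_{ij}`. -/
def symMat (p : Sym2 (Fin n) → ℝ) : Matrix (Fin n) (Fin n) ℝ := fun i j => p s(i, j)

lemma symMat_apply (p : Sym2 (Fin n) → ℝ) (i j : Fin n) : symMat p i j = p s(i, j) := rfl

lemma symMat_add (p p' : Sym2 (Fin n) → ℝ) : symMat (p + p') = symMat p + symMat p' := rfl

lemma symMat_smul (t : ℝ) (p : Sym2 (Fin n) → ℝ) : symMat (t • p) = t • symMat p := rfl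

lemma continuous_symMat : Continuous (symMat : (Sym2 (Fin n) → ℝ) → Matrix (Fin n) (Fin n) ℝ) :=
  continuous_pi fun _ => continuous_pi fun _ => continuous_apply _

/-- The coordinates `p_{ij}` of a symmetric bilinear form. -/
def symCoord (h : (Fin n → ℝ) →ₗ[ℝ] (Fin n → ℝ) →ₗ[ℝ] ℝ) (hs : ∀ a b, h a b = h b a) :
    Sym2 (Fin n) → ℝ :=
  fun s => Sym2.lift ⟨fun i j => h (Pi.single i 1) (Pi.single j 1), fun _ _ => hs _ _⟩ s

lemma dotProduct_symMat_symCoord (h : (Fin n → ℝ) →ₗ[ℝ] (Fin n → ℝ) →ₗ[ℝ] ℝ)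
    (hs : ∀ a b, h a b = h b a) (a b : Fin n → ℝ) :
    a ⬝ᵥ (symMat (symCoord h hs)).mulVec b = h a b := by
  have h1 : Matrix.toBilin' (symMat (symCoord h hs)) = h := by
    refine LinearMap.ext_basis (Pi.basisFun ℝ (Fin n)) (Pi.basisFun ℝ (Fin n)) fun i j => ?_
    simp only [Pi.basisFun_apply, Matrix.toBilin'_single]
    rfl
  rw [← Matrix.toBilin'_apply', h1]

lemma symm_symMat (p : Sym2 (Fin n) → ℝ) (a b : Fin n → ℝ) :
    a ⬝ᵥ (symMat p).mulVec b = b ⬝ᵥ (symMat p).mulVec a := by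
  have : (symMat p).transpose = symMat p := by
    ext i j
    simp [symMat, Sym2.eq_swap]
  rw [Matrix.dotProduct_mulVec, dotProduct_comm, ← Matrix.mulVec_transpose, this]

/-- The rows of `(A | B)` are independent, hence so are the vectors `x A` with `x (B - A P) = 0`. -/
lemma vecMul_ne_zero {A B P : Matrix (Fin n) (Fin n) ℝ}
    (hAB : A * A.transpose + B * B.transpose = 1)
    {x : Fin n → ℝ} (hx : Matrix.vecMul x (B - A * P) = 0) (hx0 : x ≠ 0) : Matrix.vecMul x A ≠ 0 := by
  intro hA
  apply hx0
  rw [Matrix.vecMul_sub, ← Matrix.vecMul_vecMul, hA, Matrix.zero_vecMul, sub_zero] at hx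
  rw [← Matrix.vecMul_one x, ← hAB, Matrix.vecMul_add, ← Matrix.vecMul_vecMul,
    ← Matrix.vecMul_vecMul, hA, hx, Matrix.zero_vecMul, Matrix.zero_vecMul, add_zero]

lemma finrank_ker_transpose (N : Matrix (Fin n) (Fin n) ℝ) :
    finrank ℝ (LinearMap.ker N.transpose.mulVecLin) = finrank ℝ (LinearMap.ker N.mulVecLin) := by
  have h1 := LinearMap.finrank_range_add_finrank_ker N.mulVecLin
  have h2 := LinearMap.finrank_range_add_finrank_ker N.transpose.mulVecLin
  have h3 : N.transpose.rank = N.rank := Matrix.rank_transpose N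
  unfold Matrix.rank at h3
  omega

/-- The matrix form of `apply_ne_zero_of_degenerate`, with `K` the image under `A` of the left
kernel of `B - A P` and `K'` its right kernel. The dimensions agree because `A` is injective on the
left kernel (`vecMul_ne_zero`) and a matrix has the rank of its transpose. -/
lemma dotProduct_ne_zero_of_degenerate {A B P : Matrix (Fin n) (Fin n) ℝ}
    (hAB : A * A.transpose + B * B.transpose = 1) {c c' : Fin n → ℝ} (hc : c ≠ 0) (hc' : c' ≠ 0)
    (H : ∀ h : Sym2 (Fin n) → ℝ, c ⬝ᵥ (symMat h).mulVec c' = 0 →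
      ∃ u : Fin n → ℝ, u ≠ 0 ∧ (B - A * P).mulVec u = 0 ∧
        ∀ x, Matrix.vecMul x (B - A * P) = 0 →
          Matrix.vecMul x A ⬝ᵥ (symMat h).mulVec u = 0)
    {x u : Fin n → ℝ} (hx : Matrix.vecMul x (B - A * P) = 0) (hx0 : x ≠ 0)
    (hu : (B - A * P).mulVec u = 0) (hu0 : u ≠ 0)
    (h : Sym2 (Fin n) → ℝ) (hcc : c ⬝ᵥ (symMat h).mulVec c' ≠ 0) :
    Matrix.vecMul x A ⬝ᵥ (symMat h).mulVec u ≠ 0 := by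
  set N := B - A * P with hN
  have hinj : ∀ y ∈ LinearMap.ker N.transpose.mulVecLin, A.transpose.mulVecLin y = 0 → y = 0 := by
    intro y hy hy0
    by_contra hne
    rw [LinearMap.mem_ker, Matrix.mulVecLin_apply, Matrix.mulVec_transpose] at hy
    exact vecMul_ne_zero hAB hy hne (by rwa [Matrix.mulVecLin_apply, Matrix.mulVec_transpose] at hy0)
  have hfin : finrank ℝ ((LinearMap.ker N.transpose.mulVecLin).map A.transpose.mulVecLin)
      = finrank ℝ (LinearMap.ker N.mulVecLin) := by
    rw [← finrank_ker_transpose]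
    have := LinearMap.finrank_range_of_inj
      (f := A.transpose.mulVecLin.domRestrict (LinearMap.ker N.transpose.mulVecLin)) (by
        rw [← LinearMap.ker_eq_bot, LinearMap.ker_eq_bot']
        rintro ⟨y, hy⟩ hy0
        exact Subtype.ext (hinj y hy hy0))
    rwa [LinearMap.range_domRestrict] at this
  have := apply_ne_zero_of_degenerate _ _ hfin hc hc' (fun k hk hk0 => by
      obtain ⟨u, hu0, hu, hux⟩ := H (symCoord k hk) (by rw [dotProduct_symMat_symCoord, hk0])
      refine ⟨u, by simpa using hu, hu0, ?_⟩
      rintro _ ⟨y, hy, rfl⟩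
      rw [SetLike.mem_coe, LinearMap.mem_ker, Matrix.mulVecLin_apply, Matrix.mulVec_transpose] at hy
      have := hux y hy
      rwa [dotProduct_symMat_symCoord, ← Matrix.mulVec_transpose] at this)
    (r := Matrix.vecMul x A) (u := u) ⟨x, by
      rw [SetLike.mem_coe, LinearMap.mem_ker, Matrix.mulVecLin_apply, Matrix.mulVec_transpose, hx],
      by rw [Matrix.mulVecLin_apply, Matrix.mulVec_transpose]⟩ (vecMul_ne_zero hAB hx hx0)
    (by simpa using hu) hu0 (Matrix.toBilin' (symMat h))
    (fun a b => by rw [Matrix.toBilin'_apply', Matrix.toBilin'_apply', symm_symMat])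
    (by rwa [Matrix.toBilin'_apply'])
  rwa [Matrix.toBilin'_apply'] at this

/-- A rescaled square `ξ ⊗ ξ` works when `ξ` kills neither vector. It supplies a direction
transversal to the equation inside the fibre. -/
lemma exists_symMat_eq_one {c c' : Fin n → ℝ} (hc : c ≠ 0) (hc' : c' ≠ 0) :
    ∃ h : Sym2 (Fin n) → ℝ, c ⬝ᵥ (symMat h).mulVec c' = 1 := by
  obtain ⟨ξ, h1, h2⟩ := exists_form_ne_zero hc hc'
  have hs : ∀ a b, (ξ.smulRight ξ : (Fin n → ℝ) →ₗ[ℝ] (Fin n → ℝ) →ₗ[ℝ] ℝ) a b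
      = (ξ.smulRight ξ : (Fin n → ℝ) →ₗ[ℝ] (Fin n → ℝ) →ₗ[ℝ] ℝ) b a :=
    fun a b => by simp [mul_comm]
  refine ⟨(ξ c * ξ c')⁻¹ • symCoord _ hs, ?_⟩
  rw [symMat_smul, Matrix.smul_mulVec, dotProduct_smul, dotProduct_symMat_symCoord]
  simp only [LinearMap.smulRight_apply, LinearMap.smul_apply, smul_eq_mul]
  exact inv_mul_cancel₀ (mul_ne_zero h1 h2)

lemma exists_unit_mulVec {N : Matrix (Fin n) (Fin n) ℝ} (h : N.det = 0) :
    ∃ u ∈ Metric.sphere (0 : Fin n → ℝ) 1, N.mulVec u = 0 := by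
  obtain ⟨u, hu, h0⟩ := Matrix.exists_mulVec_eq_zero_iff.2 h
  refine ⟨‖u‖⁻¹ • u, ?_, by rw [Matrix.mulVec_smul, h0, smul_zero]⟩
  rw [mem_sphere_zero_iff_norm, norm_smul, norm_inv, norm_norm,
    inv_mul_cancel₀ (norm_ne_zero_iff.2 hu)]

lemma exists_unit_vecMul {N : Matrix (Fin n) (Fin n) ℝ} (h : N.det = 0) :
    ∃ u ∈ Metric.sphere (0 : Fin n → ℝ) 1, Matrix.vecMul u N = 0 := by
  obtain ⟨u, hu, h0⟩ := exists_unit_mulVec (N := N.transpose) (by rwa [Matrix.det_transpose])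
  exact ⟨u, hu, by rwa [Matrix.mulVec_transpose] at h0⟩

lemma ne_zero_of_mem_sphere' {u : Fin n → ℝ} (hu : u ∈ Metric.sphere (0 : Fin n → ℝ) 1) :
    u ≠ 0 := by
  rintro rfl
  simp at hu

end SymmetricMatrices

/-! ### Compactness along ultrafilters and persistence of zeros. -/

section Limits

/-- Any selection with values in a compact set converges along an ultrafilter, so no subsequences
and no regularity of the selection are needed. -/
lemma exists_tendsto_of_eventually_exists {Q Z : Type*} [TopologicalSpace Z]
    (𝒰 : Ultrafilter Q) {K : Set Z} (hK : IsCompact K) {R : Q → Z → Prop}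
    (h : ∀ᶠ q in 𝒰, ∃ z ∈ K, R q z) :
    ∃ z₀ ∈ K, ∃ z : Q → Z, Tendsto z 𝒰 (𝓝 z₀) ∧ ∀ᶠ q in 𝒰, R q (z q) := by
  classical
  obtain ⟨q₀, z₁, -, -⟩ := h.exists
  have : Nonempty Z := ⟨z₁⟩
  choose! z hz using fun q (hq : ∃ z ∈ K, R q z) => hq
  obtain ⟨z₀, hz₀, hle⟩ := hK.ultrafilter_le_nhds (𝒰.map z) (by
    rw [Ultrafilter.coe_map, le_principal_iff, mem_map]
    exact h.mono fun q hq => (hz q hq).1)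
  exact ⟨z₀, hz₀, z, hle, h.mono fun q hq => (hz q hq).2⟩

lemma eventually_pos_of_hasFDerivAt {P : Type*} [NormedAddCommGroup P] [NormedSpace ℝ P]
    {f : P → ℝ} {T : P →L[ℝ] ℝ} {p : P} (hf : HasFDerivAt f T p) (h0 : f p = 0) {g : P}
    (hg : 0 < T g) : ∀ᶠ s : ℝ in 𝓝[>] 0, 0 < f (p + s • g) := by
  have h1 : HasDerivAt (fun s : ℝ => p + s • g) g 0 := by
    simpa using ((hasDerivAt_id (0 : ℝ)).smul_const g).const_add p
  have h2 : HasDerivAt (fun s : ℝ => f (p + s • g)) (T g) 0 :=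
    HasFDerivAt.comp_hasDerivAt (0 : ℝ) (l := f) (by simpa using hf) h1
  rw [hasDerivAt_iff_tendsto_slope] at h2
  have h3 := (h2.mono_left (nhdsWithin_mono (0 : ℝ) (s := Set.Ioi 0)
    fun s hs => (ne_of_gt hs : s ≠ 0))).eventually (lt_mem_nhds hg)
  filter_upwards [h3, self_mem_nhdsWithin] with s hs hs0
  rw [slope_def_field, zero_smul, add_zero, h0, sub_zero, sub_zero] at hs
  exact (div_pos_iff_of_pos_right hs0).1 hs

/-- To first order `f (p + s • g)` is `s * T g`, so for small `s > 0` the signs of `f` are those of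
`T g` and `T g'`. -/
lemma eventually_sign_change {P : Type*} [NormedAddCommGroup P] [NormedSpace ℝ P]
    {f : P → ℝ} {T : P →L[ℝ] ℝ} {p : P} (hf : HasFDerivAt f T p) (h0 : f p = 0) {ρ : ℝ} (hρ : 0 < ρ)
    {g g' : P} (hg : T g < 0) (hg' : 0 < T g') :
    ∀ᶠ s : ℝ in 𝓝[>] 0, 0 < s ∧ f (p + s • g) < 0 ∧ 0 < f (p + s • g') ∧
      p + s • g ∈ Metric.ball p ρ ∧ p + s • g' ∈ Metric.ball p ρ := by
  have hball : ∀ k : P, ∀ᶠ s : ℝ in 𝓝[>] 0, p + s • k ∈ Metric.ball p ρ := by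
    intro k
    have : Continuous fun s : ℝ => p + s • k := by fun_prop
    exact (this.continuousAt.eventually (Metric.isOpen_ball.mem_nhds (by simpa using hρ))
      : ∀ᶠ s : ℝ in 𝓝 0, p + s • k ∈ Metric.ball p ρ).filter_mono nhdsWithin_le_nhds
  have hneg := eventually_pos_of_hasFDerivAt hf.neg (by rw [Pi.neg_apply, h0, neg_zero]) (g := g)
    (by rw [neg_apply]; exact neg_pos.2 hg)
  filter_upwards [self_mem_nhdsWithin, hneg, eventually_pos_of_hasFDerivAt hf h0 hg', hball g,
    hball g'] with s h1 h2 h3 h4 h5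
  exact ⟨h1, neg_pos.1 h2, h3, h4, h5⟩

/-- A sign change of `F (x₀, ·)` along a segment persists for nearby segments. -/
lemma eventually_exists_zero {X P : Type*} [TopologicalSpace X] [NormedAddCommGroup P]
    [NormedSpace ℝ P] {F : X × P → ℝ} {U : Set X} (hU : IsOpen U) {p₀ : P} {ρ : ℝ}
    (hF : ContinuousOn F (U ×ˢ Metric.ball p₀ ρ)) {x₀ : X} (hx : x₀ ∈ U) {p g : P} {a b : ℝ}
    (hab : a ≤ b) (ha : p + a • g ∈ Metric.ball p₀ ρ) (hb : p + b • g ∈ Metric.ball p₀ ρ)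
    (hFa : F (x₀, p + a • g) < 0) (hFb : 0 < F (x₀, p + b • g)) :
    ∀ᶠ q in 𝓝 (x₀, p), ∃ τ ∈ Set.Icc a b,
      (q.1, q.2 + τ • g) ∈ U ×ˢ Metric.ball p₀ ρ ∧ F (q.1, q.2 + τ • g) = 0 := by
  have hW : IsOpen (U ×ˢ Metric.ball p₀ ρ) := hU.prod Metric.isOpen_ball
  have hmove : ∀ t : ℝ, Continuous fun q : X × P => (q.1, q.2 + t • g) := fun t => by fun_prop
  have hmem : ∀ t : ℝ, p + t • g ∈ Metric.ball p₀ ρ →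
      ∀ᶠ q in 𝓝 (x₀, p), (q.1, q.2 + t • g) ∈ U ×ˢ Metric.ball p₀ ρ := fun t ht =>
    (hmove t).continuousAt.eventually (hW.mem_nhds ⟨hx, ht⟩)
  have hcont : ∀ t : ℝ, p + t • g ∈ Metric.ball p₀ ρ →
      ContinuousAt (fun q : X × P => F (q.1, q.2 + t • g)) (x₀, p) := fun t ht =>
    ContinuousAt.comp (f := fun q : X × P => (q.1, q.2 + t • g)) (g := F)
      (hF.continuousAt (hW.mem_nhds ⟨hx, ht⟩)) (hmove t).continuousAt
  filter_upwards [hmem a ha, hmem b hb, (hcont a ha).eventually (gt_mem_nhds hFa),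
    (hcont b hb).eventually (lt_mem_nhds hFb)] with q h1 h2 h3 h4
  have hin : ∀ τ ∈ Set.Icc a b, (q.1, q.2 + τ • g) ∈ U ×ˢ Metric.ball p₀ ρ := by
    intro τ hτ
    refine ⟨h1.1, ?_⟩
    -- The ball is convex, so the whole parameter interval stays inside once its two endpoints do.
    have hconv : Convex ℝ {t : ℝ | q.2 + t • g ∈ Metric.ball p₀ ρ} := by
      intro s hs t ht u v hu hv huv
      have := convex_ball p₀ ρ hs ht hu hv huv
      have e : u • (q.2 + s • g) + v • (q.2 + t • g) = q.2 + (u • s + v • t) • g := by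
        calc _ = (u + v) • q.2 + (u • s + v • t) • g := by
              simp only [smul_add, add_smul, smul_smul, smul_eq_mul]; abel
          _ = _ := by rw [huv, one_smul]
      rwa [e] at this
    exact hconv.ordConnected.out h1.2 h2.2 hτ
  have hc : ContinuousOn (fun τ : ℝ => F (q.1, q.2 + τ • g)) (Set.Icc a b) :=
    hF.comp (Continuous.continuousOn (by fun_prop)) hin
  obtain ⟨τ, hτ, h0⟩ := intermediate_value_Icc hab hc ⟨h3.le, h4.le⟩
  exact ⟨τ, hτ, hin τ hτ, h0⟩

end Limits

/-! ### The equation `F = 0` against the determinantal set. -/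

section Comparison

open Module

variable {n : ℕ}

lemma sub_mul_symMat (A B : Matrix (Fin n) (Fin n) ℝ) (p g : Sym2 (Fin n) → ℝ) (t : ℝ) :
    B - A * symMat (p + t • g) = (B - A * symMat p) - t • (A * symMat g) := by
  rw [symMat_add, symMat_smul, mul_add, Matrix.mul_smul, sub_sub]

/-- Multiplying on the left by `x` removes `N`, and the remaining term can be divided by `t`. This
extracts the first-order condition before the limit `t → 0`. -/
lemma dotProduct_eq_zero_of_mulVec {N A G : Matrix (Fin n) (Fin n) ℝ} {x u : Fin n → ℝ} {t : ℝ}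
    (hx : Matrix.vecMul x N = 0) (ht : t ≠ 0) (hu : (N - t • (A * G)).mulVec u = 0) :
    Matrix.vecMul x A ⬝ᵥ G.mulVec u = 0 := by
  have h : x ⬝ᵥ (N - t • (A * G)).mulVec u = 0 := by rw [hu, dotProduct_zero]
  rw [Matrix.dotProduct_mulVec, Matrix.vecMul_sub, hx, zero_sub, neg_dotProduct, neg_eq_zero,
    Matrix.vecMul_smul, smul_dotProduct, smul_eq_mul, mul_eq_zero, ← Matrix.vecMul_vecMul,
    ← Matrix.dotProduct_mulVec] at h
  exact h.resolve_left ht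

lemma isCompact_entries : IsCompact
    {A : Matrix (Fin n) (Fin n) ℝ | ∀ i j, A i j ∈ Set.Icc (-1 : ℝ) 1} := by
  have h : IsCompact (Set.univ.pi fun _ : Fin n => Set.univ.pi fun _ : Fin n => Set.Icc (-1 : ℝ) 1) :=
    isCompact_univ_pi fun _ => isCompact_univ_pi fun _ => isCompact_Icc
  have e : {A : Matrix (Fin n) (Fin n) ℝ | ∀ i j, A i j ∈ Set.Icc (-1 : ℝ) 1} =
      (Set.univ.pi fun _ : Fin n => Set.univ.pi fun _ : Fin n => Set.Icc (-1 : ℝ) 1) :=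
    Set.ext fun A => ⟨fun hA i _ j _ => hA i j, fun hA i j => hA i trivial j trivial⟩
  rw [e]
  exact h

lemma entries_mem_Icc {A B : Matrix (Fin n) (Fin n) ℝ}
    (hAB : A * A.transpose + B * B.transpose = 1) (i j : Fin n) :
    A i j ∈ Set.Icc (-1 : ℝ) 1 ∧ B i j ∈ Set.Icc (-1 : ℝ) 1 := by
  have h := congrFun (congrFun hAB i) i
  simp only [Matrix.add_apply, Matrix.mul_apply, Matrix.transpose_apply, Matrix.one_apply_eq] at h
  have hA : A i j * A i j ≤ ∑ k, A i k * A i k :=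
    Finset.single_le_sum (f := fun k => A i k * A i k) (fun k _ => mul_self_nonneg _)
      (Finset.mem_univ j)
  have hB : B i j * B i j ≤ ∑ k, B i k * B i k :=
    Finset.single_le_sum (f := fun k => B i k * B i k) (fun k _ => mul_self_nonneg _)
      (Finset.mem_univ j)
  have hA0 : 0 ≤ ∑ k, A i k * A i k := Finset.sum_nonneg fun k _ => mul_self_nonneg _
  have hB0 : 0 ≤ ∑ k, B i k * B i k := Finset.sum_nonneg fun k _ => mul_self_nonneg _
  exact ⟨abs_le.1 (abs_le_one_iff_mul_self_le_one.2 (by linarith)),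
    abs_le.1 (abs_le_one_iff_mul_self_le_one.2 (by linarith))⟩

/-- Let `F` vanish only where `B - A P` is singular, and let the derivative of `F` in the direction
of the symmetric matrices be `c ∨ c'` at the point `(x₀, p₀)` of `F = 0`. If `A`, `B` converge along
a filter finer than `𝓝 x₀`, then the tangent space of `F (x₀, ·) = 0` consists of matrices which
degenerate on the two kernels of the limit of `B - A P`. -/
lemma degenerate_of_limit {X : Type*} [TopologicalSpace X]
    {F : X × (Sym2 (Fin n) → ℝ) → ℝ} {U : Set X} (hU : IsOpen U) {p₀ : Sym2 (Fin n) → ℝ} {ρ : ℝ}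
    (hρ : 0 < ρ) (hF : ContinuousOn F (U ×ˢ Metric.ball p₀ ρ)) {x₀ : X} (hx : x₀ ∈ U)
    (hF0 : F (x₀, p₀) = 0) {T : (Sym2 (Fin n) → ℝ) →L[ℝ] ℝ}
    (hT : HasFDerivAt (fun p => F (x₀, p)) T p₀)
    {A B : X → Matrix (Fin n) (Fin n) ℝ}
    (hdet : ∀ q ∈ U ×ˢ Metric.ball p₀ ρ, F q = 0 → (B q.1 - A q.1 * symMat q.2).det = 0)
    (𝒰 : Ultrafilter X) (h𝒰 : (𝒰 : Filter X) ≤ 𝓝 x₀) {A₀ B₀ : Matrix (Fin n) (Fin n) ℝ}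
    (hA : Tendsto A 𝒰 (𝓝 A₀)) (hB : Tendsto B 𝒰 (𝓝 B₀))
    {g h : Sym2 (Fin n) → ℝ} (hg : 0 < T g) (hh : T h = 0) :
    ∃ u : Fin n → ℝ, u ≠ 0 ∧ (B₀ - A₀ * symMat p₀).mulVec u = 0 ∧
        ∀ x, Matrix.vecMul x (B₀ - A₀ * symMat p₀) = 0 →
          Matrix.vecMul x A₀ ⬝ᵥ (symMat h).mulVec u = 0 := by
  -- The triple `z` is `(s, σ, u)`: the limiting determinant vanishes at `p₀ + s (h + σ g)`, a point
  -- approaching `p₀` in the direction `h`, and `u` is a unit kernel vector there.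
  have step : ∀ ε ∈ Set.Ioo (0 : ℝ) 1, ∃ z ∈ Set.Icc (0 : ℝ) 1 ×ˢ Set.Icc (-1 : ℝ) 1 ×ˢ
      Metric.sphere (0 : Fin n → ℝ) 1, 0 < z.1 ∧ z.1 ≤ ε ∧ |z.2.1| ≤ ε ∧
      ((B₀ - A₀ * symMat p₀) - z.1 • (A₀ * symMat (h + z.2.1 • g))).mulVec z.2.2 = 0 := by
    rintro ε ⟨hε, hε1⟩
    have hlt : ∀ᶠ s : ℝ in 𝓝[>] 0, s < ε := (gt_mem_nhds hε).filter_mono nhdsWithin_le_nhds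
    -- Since `T h = 0`, the derivative on `h ∓ ε g` is `∓ ε T g`. A zero of `F` therefore lies
    -- between the corresponding points, and it persists for nearby base points.
    obtain ⟨s, ⟨hs0, hs2, hs1, hs4, hs3⟩, hs5⟩ := ((eventually_sign_change hT hF0 hρ
      (g := h + (-ε) • g) (g' := h + ε • g)
      (by rw [map_add, hh, map_smul, zero_add, smul_eq_mul, neg_mul]; exact neg_neg_of_pos (mul_pos hε hg))
      (by rw [map_add, hh, map_smul, zero_add]; exact mul_pos hε hg)).and hlt).exists
    have e : ∀ σ : ℝ, p₀ + s • h + σ • (s • g) = p₀ + s • (h + σ • g) := fun σ => by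
      rw [smul_add, smul_comm, add_assoc]
    have hz := eventually_exists_zero hU hF hx (p := p₀ + s • h) (g := s • g) (a := -ε) (b := ε)
      (by linarith) (by rwa [e]) (by rwa [e]) (by rwa [e]) (by rwa [e])
    have hz' : ∀ᶠ x in 𝓝 x₀, ∃ σ ∈ Set.Icc (-ε) ε,
        (B x - A x * symMat (p₀ + s • (h + σ • g))).det = 0 := by
      have hc : Continuous fun x : X => (x, p₀ + s • h) := by fun_prop
      filter_upwards [hc.continuousAt.eventually hz] with x hx
      obtain ⟨σ, hσ, h1, h2⟩ := hx
      refine ⟨σ, hσ, ?_⟩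
      rw [← e]
      exact hdet _ h1 h2
    obtain ⟨σ₀, hσ₀, σ, hσ, hev⟩ := exists_tendsto_of_eventually_exists 𝒰 isCompact_Icc
      (h𝒰 hz')
    have hlim : Tendsto (fun x => (B x - A x * symMat (p₀ + s • (h + σ x • g))).det) 𝒰
        (𝓝 (B₀ - A₀ * symMat (p₀ + s • (h + σ₀ • g))).det) := by
      have hc : Continuous fun z : Matrix (Fin n) (Fin n) ℝ × Matrix (Fin n) (Fin n) ℝ × ℝ =>
          (z.1 - z.2.1 * symMat (p₀ + s • (h + z.2.2 • g))).det := by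
        have : Continuous fun z : Matrix (Fin n) (Fin n) ℝ × Matrix (Fin n) (Fin n) ℝ × ℝ =>
          symMat (p₀ + s • (h + z.2.2 • g)) := continuous_symMat.comp (by fun_prop)
        exact (continuous_fst.sub (continuous_snd.fst.mul this)).matrix_det
      exact (hc.tendsto (B₀, A₀, σ₀)).comp (hB.prodMk_nhds (hA.prodMk_nhds hσ))
    have hdet0 := tendsto_nhds_unique (hlim.congr' hev) tendsto_const_nhds
    obtain ⟨u, hu, hu0⟩ := exists_unit_mulVec hdet0
    rw [sub_mul_symMat] at hu0
    exact ⟨(s, σ₀, u), ⟨⟨hs0.le, by linarith⟩, ⟨by linarith [hσ₀.1], by linarith [hσ₀.2]⟩, hu⟩, hs0,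
      hs5.le, abs_le.2 hσ₀, hu0⟩
  -- The limit in the base point has been taken at fixed `ε`; now `ε` tends to `0`.
  set 𝒱 := Ultrafilter.of (𝓝[>] (0 : ℝ))
  have h𝒱 : (𝒱 : Filter ℝ) ≤ 𝓝[>] 0 := Ultrafilter.of_le _
  obtain ⟨⟨s₀, σ₀, u₀⟩, ⟨-, -, hu₀⟩, z, hz, hev⟩ := exists_tendsto_of_eventually_exists 𝒱
    (isCompact_Icc.prod (isCompact_Icc.prod (isCompact_sphere _ _)))
    (h𝒱 (Filter.mem_of_superset (Ioo_mem_nhdsGT one_pos) step))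
  have hid : Tendsto (fun ε : ℝ => ε) 𝒱 (𝓝 0) := h𝒱.trans nhdsWithin_le_nhds
  have hz1 : Tendsto (fun ε => (z ε).1) 𝒱 (𝓝 s₀) := (continuous_fst.tendsto _).comp hz
  have hz2 : Tendsto (fun ε => (z ε).2.1) 𝒱 (𝓝 σ₀) := (continuous_snd.fst.tendsto _).comp hz
  have hs₀ : s₀ = 0 := tendsto_nhds_unique hz1 (squeeze_zero' (hev.mono fun _ h => h.1.le)
    (hev.mono fun _ h => h.2.1) hid)
  have hσ₀ : σ₀ = 0 := tendsto_nhds_unique hz2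
    (squeeze_zero_norm' (hev.mono fun _ h => h.2.2.1) hid)
  subst hs₀ hσ₀
  refine ⟨u₀, ne_zero_of_mem_sphere' hu₀, ?_, fun x hxN => ?_⟩
  · have hc : Continuous fun z : ℝ × ℝ × (Fin n → ℝ) =>
        ((B₀ - A₀ * symMat p₀) - z.1 • (A₀ * symMat (h + z.2.1 • g))).mulVec z.2.2 := by
      have : Continuous fun z : ℝ × ℝ × (Fin n → ℝ) => symMat (h + z.2.1 • g) :=
        continuous_symMat.comp (by fun_prop)
      exact (continuous_const.sub (continuous_fst.smul (continuous_const.mul this))).matrix_mulVec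
        continuous_snd.snd
    have := tendsto_nhds_unique (((hc.tendsto _).comp hz).congr' (hev.mono fun _ h => h.2.2.2))
      tendsto_const_nhds
    simpa using this
  · have hc : Continuous fun z : ℝ × ℝ × (Fin n → ℝ) =>
        Matrix.vecMul x A₀ ⬝ᵥ (symMat (h + z.2.1 • g)).mulVec z.2.2 := by
      have : Continuous fun z : ℝ × ℝ × (Fin n → ℝ) => symMat (h + z.2.1 • g) :=
        continuous_symMat.comp (by fun_prop)
      exact continuous_const.dotProduct (this.matrix_mulVec continuous_snd.snd)
    have := tendsto_nhds_unique (((hc.tendsto _).comp hz).congr' (hev.mono fun ε hε =>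
      dotProduct_eq_zero_of_mulVec hxN hε.1.ne' hε.2.2.2))
      tendsto_const_nhds
    simpa using this

/-- The hypersurface `F = 0` coincides near `(x₀, p₀)` with the set where `B - A P` is singular,
even if `A`, `B` are not continuous. -/
theorem eventually_eq_zero_of_det {X : Type*} [TopologicalSpace X]
    {F : X × (Sym2 (Fin n) → ℝ) → ℝ} {U : Set X} (hU : IsOpen U) {p₀ : Sym2 (Fin n) → ℝ} {ρ : ℝ}
    (hρ : 0 < ρ) (hF : ContinuousOn F (U ×ˢ Metric.ball p₀ ρ)) {x₀ : X} (hx : x₀ ∈ U)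
    (hF0 : F (x₀, p₀) = 0) {T : (Sym2 (Fin n) → ℝ) →L[ℝ] ℝ}
    (hT : HasFDerivAt (fun p => F (x₀, p)) T p₀) {c c' : Fin n → ℝ} (hc : c ≠ 0) (hc' : c' ≠ 0)
    (hTc : ∀ h, T h = c ⬝ᵥ (symMat h).mulVec c')
    {A B : X → Matrix (Fin n) (Fin n) ℝ}
    (hAB : ∀ᶠ x in 𝓝 x₀, A x * (A x).transpose + B x * (B x).transpose = 1)
    (hdet : ∀ q ∈ U ×ˢ Metric.ball p₀ ρ, F q = 0 → (B q.1 - A q.1 * symMat q.2).det = 0) :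
    ∀ᶠ q in 𝓝 (x₀, p₀), (B q.1 - A q.1 * symMat q.2).det = 0 → F q = 0 := by
  by_contra hcon
  rw [Filter.not_eventually, Filter.frequently_iff_neBot] at hcon
  -- An ultrafilter of bad points, with vanishing determinant but `F ≠ 0`, converging to `(x₀, p₀)`.
  set 𝒬 := @Ultrafilter.of _ _ hcon
  have h𝒬 : (𝒬 : Filter _) ≤ 𝓝 (x₀, p₀) ⊓ 𝓟 _ := @Ultrafilter.of_le _ _ hcon
  have h𝒬1 : (𝒬 : Filter _) ≤ 𝓝 (x₀, p₀) := h𝒬.trans inf_le_left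
  have hbad : ∀ᶠ q in 𝒬, (B q.1 - A q.1 * symMat q.2).det = 0 ∧ F q ≠ 0 := by
    have : ∀ᶠ q in 𝒬, ¬((B q.1 - A q.1 * symMat q.2).det = 0 → F q = 0) :=
      h𝒬.trans inf_le_right (mem_principal_self _)
    exact this.mono fun q hq => by tauto
  have hfst : Tendsto Prod.fst (𝒬 : Filter (X × (Sym2 (Fin n) → ℝ))) (𝓝 x₀) :=
    (continuous_fst.tendsto _).comp h𝒬1
  have hsnd : Tendsto Prod.snd (𝒬 : Filter (X × (Sym2 (Fin n) → ℝ))) (𝓝 p₀) :=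
    (continuous_snd.tendsto _).comp h𝒬1
  have hAB' := hfst.eventually hAB
  -- The relation `Z = A q.1` leaves no choice, so this says that `A` itself has a limit along `𝒬`,
  -- its entries being bounded by the normalisation.
  obtain ⟨A₀, -, A', hA', hAA'⟩ := exists_tendsto_of_eventually_exists 𝒬 isCompact_entries
    (R := fun q Z => Z = A q.1)
    (hAB'.mono fun q hq => ⟨_, fun i j => (entries_mem_Icc hq i j).1, rfl⟩)
  obtain ⟨B₀, -, B', hB', hBB'⟩ := exists_tendsto_of_eventually_exists 𝒬 isCompact_entries
    (R := fun q Z => Z = B q.1)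
    (hAB'.mono fun q hq => ⟨_, fun i j => (entries_mem_Icc hq i j).2, rfl⟩)
  replace hA' := hA'.congr' hAA'
  replace hB' := hB'.congr' hBB'
  have hAB₀ : A₀ * A₀.transpose + B₀ * B₀.transpose = 1 := by
    have hc : Continuous fun z : Matrix (Fin n) (Fin n) ℝ × Matrix (Fin n) (Fin n) ℝ =>
        z.1 * z.1.transpose + z.2 * z.2.transpose :=
      (continuous_fst.mul continuous_fst.matrix_transpose).add
        (continuous_snd.mul continuous_snd.matrix_transpose)
    exact tendsto_nhds_unique (((hc.tendsto _).comp (hA'.prodMk_nhds hB')).congr' hAB')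
      tendsto_const_nhds
  obtain ⟨g, hg⟩ := exists_symMat_eq_one hc hc'
  have hTg : 0 < T g := by rw [hTc, hg]; exact one_pos
  have hdeg := fun h hh => degenerate_of_limit hU hρ hF hx hF0 hT hdet (𝒬.map Prod.fst) hfst
    (A₀ := A₀) (B₀ := B₀) (tendsto_map'_iff.2 hA') (tendsto_map'_iff.2 hB') (h := h) hTg hh
  have hN : Continuous fun z : Matrix (Fin n) (Fin n) ℝ × Matrix (Fin n) (Fin n) ℝ ×
      (Sym2 (Fin n) → ℝ) => z.2.1 - z.1 * symMat z.2.2 :=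
    continuous_snd.fst.sub (continuous_fst.mul (continuous_symMat.comp continuous_snd.snd))
  have hNlim : Tendsto (fun q : X × (Sym2 (Fin n) → ℝ) => B q.1 - A q.1 * symMat q.2) 𝒬
      (𝓝 (B₀ - A₀ * symMat p₀)) :=
    (hN.tendsto (A₀, B₀, p₀)).comp (hA'.prodMk_nhds (hB'.prodMk_nhds hsnd))
  obtain ⟨x, hx1, y, hy, hyN⟩ := exists_tendsto_of_eventually_exists 𝒬
    (isCompact_sphere (0 : Fin n → ℝ) 1)
    (hbad.mono fun q hq => exists_unit_vecMul hq.1)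
  have hxN : Matrix.vecMul x (B₀ - A₀ * symMat p₀) = 0 := by
    have hc : Continuous fun z : (Fin n → ℝ) × Matrix (Fin n) (Fin n) ℝ =>
      Matrix.vecMul z.1 z.2 := continuous_fst.matrix_vecMul continuous_snd
    exact tendsto_nhds_unique (((hc.tendsto _).comp (hy.prodMk_nhds hNlim)).congr' hyN)
      tendsto_const_nhds
  -- From a bad point `q`, a displacement `τ g` with `|τ| ≤ s < ε` reaches `F = 0`, where the
  -- determinant vanishes again. Comparing a left kernel vector at `q` with a right one at the
  -- displaced point gives the second equation, which survives the limit along `𝒬`.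
  have step : ∀ ε ∈ Set.Ioo (0 : ℝ) 1, ∃ z ∈ Set.Icc (-1 : ℝ) 1 ×ˢ
      Metric.sphere (0 : Fin n → ℝ) 1, |z.1| ≤ ε ∧
      ((B₀ - A₀ * symMat p₀) - z.1 • (A₀ * symMat g)).mulVec z.2 = 0 ∧
      Matrix.vecMul x A₀ ⬝ᵥ (symMat g).mulVec z.2 = 0 := by
    rintro ε ⟨hε, hε1⟩
    have hlt : ∀ᶠ s : ℝ in 𝓝[>] 0, s < ε := (gt_mem_nhds hε).filter_mono nhdsWithin_le_nhds
    obtain ⟨s, ⟨hs0, hs2, hs1, hs4, hs3⟩, hs5⟩ := ((eventually_sign_change hT hF0 hρ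
      (g := -g) (g' := g) (by rw [map_neg]; exact neg_neg_of_pos hTg) hTg).and hlt).exists
    have e : (-s) • g = s • (-g) := by rw [neg_smul, smul_neg]
    have hz := eventually_exists_zero hU hF hx (p := p₀) (g := g) (a := -s) (b := s)
      (by linarith) (by rwa [e]) hs3 (by rwa [e]) hs1
    have hev : ∀ᶠ q in 𝒬, ∃ z ∈ Set.Icc (-s) s ×ˢ Metric.sphere (0 : Fin n → ℝ) 1,
        ((B q.1 - A q.1 * symMat q.2) - z.1 • (A q.1 * symMat g)).mulVec z.2 = 0 ∧
        Matrix.vecMul (y q) (A q.1) ⬝ᵥ (symMat g).mulVec z.2 = 0 := by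
      filter_upwards [hbad, h𝒬1 hz, hyN] with q hq hqz hyq
      obtain ⟨τ, hτ, h1, h2⟩ := hqz
      obtain ⟨u, hu, hu0⟩ := exists_unit_mulVec (hdet _ h1 h2)
      rw [sub_mul_symMat] at hu0
      refine ⟨(τ, u), ⟨hτ, hu⟩, hu0, ?_⟩
      -- Badness of `q` is used here: `F q ≠ 0` forces a genuine displacement, so `τ` may be
      -- cancelled.
      have hτ0 : τ ≠ 0 := by
        rintro rfl
        rw [zero_smul, add_zero] at h2
        exact hq.2 h2
      exact dotProduct_eq_zero_of_mulVec hyq hτ0 hu0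
    obtain ⟨⟨τ₀, u₀⟩, ⟨hτ₀, hu₀⟩, z, hz, hzev⟩ := exists_tendsto_of_eventually_exists 𝒬
      (isCompact_Icc.prod (isCompact_sphere _ _)) hev
    refine ⟨(τ₀, u₀), ⟨⟨by linarith [hτ₀.1], by linarith [hτ₀.2]⟩, hu₀⟩,
      abs_le.2 ⟨by linarith [hτ₀.1], by linarith [hτ₀.2]⟩, ?_, ?_⟩
    · have hc : Continuous fun w : (Matrix (Fin n) (Fin n) ℝ × Matrix (Fin n) (Fin n) ℝ) × ℝ ×
          (Fin n → ℝ) => (w.1.1 - w.2.1 • (w.1.2 * symMat g)).mulVec w.2.2 :=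
        (continuous_fst.fst.sub (continuous_snd.fst.smul
          (continuous_fst.snd.mul continuous_const))).matrix_mulVec continuous_snd.snd
      exact tendsto_nhds_unique (((hc.tendsto ((_, _), (_, _))).comp
        ((hNlim.prodMk_nhds hA').prodMk_nhds hz)).congr' (hzev.mono fun _ h => h.1))
        tendsto_const_nhds
    · have hc : Continuous fun w : ((Fin n → ℝ) × Matrix (Fin n) (Fin n) ℝ) × ℝ ×
          (Fin n → ℝ) => Matrix.vecMul w.1.1 w.1.2 ⬝ᵥ (symMat g).mulVec w.2.2 :=
        (continuous_fst.fst.matrix_vecMul continuous_fst.snd).dotProduct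
          (continuous_const.matrix_mulVec continuous_snd.snd)
      exact tendsto_nhds_unique (((hc.tendsto ((_, _), (_, _))).comp
        ((hy.prodMk_nhds hA').prodMk_nhds hz)).congr' (hzev.mono fun _ h => h.2))
        tendsto_const_nhds
  set 𝒱 := Ultrafilter.of (𝓝[>] (0 : ℝ))
  have h𝒱 : (𝒱 : Filter ℝ) ≤ 𝓝[>] 0 := Ultrafilter.of_le _
  obtain ⟨⟨τ₀, u₀⟩, ⟨-, hu₀⟩, z, hz, hev⟩ := exists_tendsto_of_eventually_exists 𝒱
    (isCompact_Icc.prod (isCompact_sphere _ _))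
    (h𝒱 (Filter.mem_of_superset (Ioo_mem_nhdsGT one_pos) step))
  have hid : Tendsto (fun ε : ℝ => ε) 𝒱 (𝓝 0) := h𝒱.trans nhdsWithin_le_nhds
  have hτ₀ : τ₀ = 0 := tendsto_nhds_unique ((continuous_fst.tendsto _).comp hz)
    (squeeze_zero_norm' (hev.mono fun _ h => h.1) hid)
  subst hτ₀
  have hu1 : (B₀ - A₀ * symMat p₀).mulVec u₀ = 0 := by
    have hc : Continuous fun w : ℝ × (Fin n → ℝ) =>
        ((B₀ - A₀ * symMat p₀) - w.1 • (A₀ * symMat g)).mulVec w.2 :=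
      (continuous_const.sub (continuous_fst.smul continuous_const)).matrix_mulVec continuous_snd
    have := tendsto_nhds_unique (((hc.tendsto _).comp hz).congr' (hev.mono fun _ h => h.2.1))
      tendsto_const_nhds
    simpa using this
  have hu2 : Matrix.vecMul x A₀ ⬝ᵥ (symMat g).mulVec u₀ = 0 := by
    have hc : Continuous fun w : ℝ × (Fin n → ℝ) =>
        Matrix.vecMul x A₀ ⬝ᵥ (symMat g).mulVec w.2 :=
      continuous_const.dotProduct (continuous_const.matrix_mulVec continuous_snd)
    exact tendsto_nhds_unique (((hc.tendsto _).comp hz).congr' (hev.mono fun _ h => h.2.2))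
      tendsto_const_nhds
  -- The vectors `x` and `u₀` lie in the two kernels of the limit matrix, so their pairing through
  -- `g` cannot vanish, against `hu2`.
  exact dotProduct_ne_zero_of_degenerate hAB₀ hc hc' (fun h hh => hdeg h (by rw [hTc, hh])) hxN
    (ne_zero_of_mem_sphere' hx1) hu1 (ne_zero_of_mem_sphere' hu₀) g (by rw [hg]; exact one_ne_zero)
    hu2

end Comparison

/-! ### Smoothness of determinants and inverses. -/

section MatrixSmoothness

variable {ι : Type*} [Fintype ι] [DecidableEq ι]
  {E' : Type*} [NormedAddCommGroup E'] [NormedSpace ℝ E'] {H : Type*} [TopologicalSpace H]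
  {I : ModelWithCorners ℝ E' H} {N : Type*} [TopologicalSpace N] [ChartedSpace H N]
  {A : N → Matrix ι ι ℝ} {x : N}

lemma contMDiffAt_det (hA : ∀ i j, ContMDiffAt I 𝓘(ℝ, ℝ) ∞ (fun y => A y i j) x) :
    ContMDiffAt I 𝓘(ℝ, ℝ) ∞ (fun y => (A y).det) x := by
  have h : ContDiff ℝ ∞ (fun B : ι → ι → ℝ => (Matrix.of B).det) := by
    simp_rw [Matrix.det_apply, Matrix.of_apply]
    fun_prop
  have hA' : ContMDiffAt I 𝓘(ℝ, ι → ι → ℝ) ∞ (fun y i j => A y i j) x :=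
    contMDiffAt_pi_space.2 fun i => contMDiffAt_pi_space.2 fun j => hA i j
  exact h.contMDiff.contMDiffAt.comp x hA'

lemma contMDiffAt_inv_apply (hA : ∀ i j, ContMDiffAt I 𝓘(ℝ, ℝ) ∞ (fun y => A y i j) x)
    (hx : (A x).det ≠ 0) (i j : ι) : ContMDiffAt I 𝓘(ℝ, ℝ) ∞ (fun y => (A y)⁻¹ i j) x := by
  have hadj : ContMDiffAt I 𝓘(ℝ, ℝ) ∞ (fun y => (A y).adjugate i j) x := by
    simp_rw [Matrix.adjugate_apply]
    refine contMDiffAt_det fun k l => ?_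
    simp_rw [Matrix.updateRow_apply]
    split_ifs
    · exact contMDiffAt_const
    · exact hA k l
  have hinv : ContMDiffAt I 𝓘(ℝ, ℝ) ∞ (fun y => ((A y).det)⁻¹) x :=
    (contDiffAt_inv ℝ hx).contMDiffAt.comp x (contMDiffAt_det hA)
  simp_rw [Matrix.inv_def, Ring.inverse_eq_inv', Matrix.smul_apply, smul_eq_mul]
  exact hinv.mul hadj

end MatrixSmoothness

/-! ### Smooth vector fields and their coefficients. -/

section Fields

variable {n : ℕ} {M : Type*} [TopologicalSpace M]
  [ChartedSpace (EuclideanSpace ℝ (Fin (2 * n + 1))) M] [IsManifold (𝓡 (2 * n + 1)) ∞ M]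

/-- Smoothness of a vector field at a point. -/
def IsSmoothFieldAt (X : (m : M) → TangentSpace (𝓡 (2 * n + 1)) m) (m₀ : M) : Prop :=
  ContMDiffAt (𝓡 (2 * n + 1)) (𝓡 (2 * n + 1)).tangent ∞
    (fun m => (⟨m, X m⟩ : TangentBundle (𝓡 (2 * n + 1)) M)) m₀

lemma IsSmoothFieldOn.at {X : (m : M) → TangentSpace (𝓡 (2 * n + 1)) m} {U : Set M}
    (hX : IsSmoothFieldOn X U) (hU : IsOpen U) {m : M} (hm : m ∈ U) : IsSmoothFieldAt X m :=
  hX.contMDiffAt (hU.mem_nhds hm)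

variable {ι : Type*} [Fintype ι] [DecidableEq ι]

/-- Local smooth `1`-forms which are dual at `m₀` to independent vectors. -/
lemma exists_dual_forms {m₀ : M} (u : ι → TangentSpace (𝓡 (2 * n + 1)) m₀)
    (hu : LinearIndependent ℝ u) :
    ∃ l : ι → (m : M) → TangentSpace (𝓡 (2 * n + 1)) m →ₗ[ℝ] ℝ,
      (∀ (Y : (m : M) → TangentSpace (𝓡 (2 * n + 1)) m), IsSmoothFieldAt Y m₀ → ∀ i,
        ContMDiffAt (𝓡 (2 * n + 1)) 𝓘(ℝ, ℝ) ∞ (fun m => l i m (Y m)) m₀) ∧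
      ∀ i j, l i m₀ (u j) = if i = j then 1 else 0 := by
  set e := trivializationAt (EuclideanSpace ℝ (Fin (2 * n + 1)))
    (TangentSpace (𝓡 (2 * n + 1)) (M := M)) m₀ with he
  have hm₀ : m₀ ∈ e.baseSet := FiberBundle.mem_baseSet_trivializationAt' m₀
  have hv : LinearIndependent ℝ (fun i => e.linearMapAt ℝ m₀ (u i)) := by
    refine hu.map' (e.linearMapAt ℝ m₀) (LinearMap.ker_eq_bot_of_injective ?_)
    intro a b hab
    have := congrArg (e.symmₗ ℝ m₀) hab
    rwa [e.symmₗ_linearMapAt hm₀, e.symmₗ_linearMapAt hm₀] at this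
  obtain ⟨Λ, hΛ⟩ := (Fintype.linearCombination ℝ (fun i => e.linearMapAt ℝ m₀ (u i))
    ).exists_leftInverse_of_injective (by
      rw [LinearMap.ker_eq_bot]
      exact hv.fintypeLinearCombination_injective)
  -- The forms have constant coefficients in the trivialization at `m₀`; `Λ` is a left inverse of
  -- the map sending coefficients to combinations of the `u i`.
  refine ⟨fun i m => (LinearMap.proj i ∘ₗ Λ) ∘ₗ e.linearMapAt ℝ m, fun Y hY i => ?_, fun i j => ?_⟩
  · have h1 := (Bundle.contMDiffAt_section m₀).1 hY
    have h2 : ContDiff ℝ ∞ (LinearMap.proj i ∘ₗ Λ : EuclideanSpace ℝ (Fin (2 * n + 1)) →ₗ[ℝ] ℝ) :=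
      (LinearMap.toContinuousLinearMap (LinearMap.proj i ∘ₗ Λ :
        EuclideanSpace ℝ (Fin (2 * n + 1)) →ₗ[ℝ] ℝ)).contDiff
    refine (h2.contMDiff.contMDiffAt.comp m₀ h1).congr_of_eventuallyEq ?_
    filter_upwards [e.open_baseSet.mem_nhds hm₀] with m hm
    simp only [LinearMap.comp_apply, Function.comp_apply]
    rw [e.coe_linearMapAt_of_mem hm]
  · have := congrArg (fun f => f (Pi.single j 1)) hΛ
    simp only [LinearMap.comp_apply, Fintype.linearCombination_apply_single, one_smul,
      LinearMap.id_apply] at this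
    simp only [LinearMap.comp_apply, LinearMap.proj_apply, this, Pi.single_apply]

/-- The matrix of dual forms evaluated on the fields is the identity at `m₀`, so its determinant
stays nonzero nearby. -/
lemma eventually_linearIndependent {u : ι → (m : M) → TangentSpace (𝓡 (2 * n + 1)) m} {m₀ : M}
    (hu : ∀ i, IsSmoothFieldAt (u i) m₀) (h : LinearIndependent ℝ fun i => u i m₀) :
    ∀ᶠ m in 𝓝 m₀, LinearIndependent ℝ fun i => u i m := by
  obtain ⟨l, hl, hl1⟩ := exists_dual_forms _ h
  have hdet := contMDiffAt_det (A := fun m => Matrix.of fun i j => l j m (u i m))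
    (fun i j => hl (u i) (hu i) j)
  have h1 : (Matrix.of fun i j => l j m₀ (u i m₀)).det ≠ 0 := by
    have : (Matrix.of fun i j => l j m₀ (u i m₀)) = 1 := by
      ext i j
      simp [hl1, Matrix.one_apply, eq_comm]
    rw [this, Matrix.det_one]
    exact one_ne_zero
  filter_upwards [hdet.continuousAt.eventually (isOpen_ne.mem_nhds h1)] with m hm
  have hrow := Matrix.linearIndependent_rows_of_det_ne_zero hm
  exact LinearIndependent.of_comp (LinearMap.pi fun j => l j m) hrow

/-- The coefficients of a smooth field with respect to independent smooth fields are smooth. -/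
lemma contMDiffAt_coeff {u : ι → (m : M) → TangentSpace (𝓡 (2 * n + 1)) m} {m₀ : M}
    (hu : ∀ i, IsSmoothFieldAt (u i) m₀) (h : LinearIndependent ℝ fun i => u i m₀)
    {X : (m : M) → TangentSpace (𝓡 (2 * n + 1)) m} (hX : IsSmoothFieldAt X m₀) {z : ι → M → ℝ}
    (hz : ∀ᶠ m in 𝓝 m₀, X m = ∑ i, z i m • u i m) (k : ι) :
    ContMDiffAt (𝓡 (2 * n + 1)) 𝓘(ℝ, ℝ) ∞ (z k) m₀ := by
  obtain ⟨l, hl, hl1⟩ := exists_dual_forms _ h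
  set A : M → Matrix ι ι ℝ := fun m => Matrix.of fun i j => l j m (u i m) with hA
  have hAs : ∀ i j, ContMDiffAt (𝓡 (2 * n + 1)) 𝓘(ℝ, ℝ) ∞ (fun m => A m i j) m₀ :=
    fun i j => hl (u i) (hu i) j
  have hdet := contMDiffAt_det hAs
  have h1 : (A m₀).det ≠ 0 := by
    have : A m₀ = 1 := by
      ext i j
      simp [hA, hl1, Matrix.one_apply, eq_comm]
    rw [this, Matrix.det_one]
    exact one_ne_zero
  -- Applying the dual forms to `X = ∑ z i • u i` gives a linear system with matrix `A`; its
  -- solution `l (X) A⁻¹` is visibly smooth.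
  have hsum : ContMDiffAt (𝓡 (2 * n + 1)) 𝓘(ℝ, ℝ) ∞
      (fun m => ∑ j, l j m (X m) * (A m)⁻¹ j k) m₀ :=
    contMDiffAt_finsetSum fun j _ => (hl X hX j).mul (contMDiffAt_inv_apply hAs h1 j k)
  refine hsum.congr_of_eventuallyEq ?_
  filter_upwards [hdet.continuousAt.eventually (isOpen_ne.mem_nhds h1), hz] with m hm hzm
  have e1 : (fun j => l j m (X m)) = Matrix.vecMul (fun i => z i m) (A m) := by
    funext j
    rw [hzm, map_sum]
    simp [Matrix.vecMul, dotProduct, hA]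
  have e2 : Matrix.vecMul (fun j => l j m (X m)) (A m)⁻¹ = fun i => z i m := by
    rw [e1, Matrix.vecMul_vecMul, Matrix.mul_nonsing_inv _ (isUnit_iff_ne_zero.2 hm),
      Matrix.vecMul_one]
  exact (congrFun e2 k).symm

end Fields

/-! ### Change of contact form rescales `dθ` on the distribution. -/

section Conformal

/-- If two `1`-forms have the same kernel near `y₀` then their differentials are proportional on
that kernel. -/
lemma exists_fderiv_eq_mul {E' : Type*} [NormedAddCommGroup E'] [NormedSpace ℝ E']
    {α β : E' → E' →L[ℝ] ℝ} {y₀ : E'} (hα : DifferentiableAt ℝ α y₀) (hβ : DifferentiableAt ℝ β y₀)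
    (hker : ∀ᶠ y in 𝓝 y₀, ∀ v, α y v = 0 ↔ β y v = 0) (h0 : α y₀ ≠ 0) :
    ∃ c : ℝ, c ≠ 0 ∧ ∀ v w, α y₀ w = 0 → fderiv ℝ β y₀ v w = c * fderiv ℝ α y₀ v w := by
  obtain ⟨v₀, hv₀⟩ : ∃ v₀, α y₀ v₀ ≠ 0 := by
    by_contra! h
    exact h0 (ContinuousLinearMap.ext h)
  have hβ₀ : β y₀ v₀ ≠ 0 := fun h => hv₀ ((hker.self_of_nhds v₀).2 h)
  refine ⟨β y₀ v₀ / α y₀ v₀, div_ne_zero hβ₀ hv₀, fun v w hw => ?_⟩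
  have hα' : ∀ u, HasFDerivAt (fun y => α y u) ((fderiv ℝ α y₀).flip u) y₀ := fun u => by
    simpa using hα.hasFDerivAt.clm_apply (hasFDerivAt_const u y₀)
  have hβ' : ∀ u, HasFDerivAt (fun y => β y u) ((fderiv ℝ β y₀).flip u) y₀ := fun u => by
    simpa using hβ.hasFDerivAt.clm_apply (hasFDerivAt_const u y₀)
  -- The vector `α(v₀) w - α(w) v₀` lies in the common kernel, whence this identity near `y₀`.
  -- Differentiating it where `α w = β w = 0` leaves `α(v₀) dβ(v)(w) = β(v₀) dα(v)(w)`.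
  have hzero : ∀ᶠ y in 𝓝 y₀, α y v₀ * β y w - β y v₀ * α y w = 0 := by
    filter_upwards [hker] with y hy
    have h1 : α y (α y v₀ • w - α y w • v₀) = 0 := by
      simp only [map_sub, map_smul, smul_eq_mul]; ring
    have h2 := (hy _).1 h1
    simp only [map_sub, map_smul, smul_eq_mul] at h2
    rcases eq_or_ne (α y v₀) 0 with h3 | h3
    · rw [h3, (hy v₀).1 h3]; ring
    · linarith
  have hd := ((hα' v₀).mul (hβ' w)).sub ((hβ' v₀).mul (hα' w))
  have hd0 := hd.unique ((hasFDerivAt_const (0 : ℝ) y₀).congr_of_eventuallyEq hzero)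
  have hβw := (hker.self_of_nhds w).1 hw
  have := congrArg (fun f => f v) hd0
  simp [hw, hβw] at this
  field_simp
  linarith

end Conformal

section ContactForms

variable {n : ℕ} {M : Type*} [TopologicalSpace M]
  [ChartedSpace (EuclideanSpace ℝ (Fin (2 * n + 1))) M] [IsManifold (𝓡 (2 * n + 1)) ∞ M]
  {C : (m : M) → Submodule ℝ (TangentSpace (𝓡 (2 * n + 1)) m)}

lemma localExpr_mfderiv (θ : (m : M) → TangentSpace (𝓡 (2 * n + 1)) m →L[ℝ] ℝ) (m : M)
    (w : TangentSpace (𝓡 (2 * n + 1)) m) :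
    localExpr θ m (extChartAt (𝓡 (2 * n + 1)) m m)
      (mfderiv (𝓡 (2 * n + 1)) 𝓘(ℝ, EuclideanSpace ℝ (Fin (2 * n + 1)))
        (extChartAt (𝓡 (2 * n + 1)) m) m w) = θ m w := by
  have h := mfderivWithin_extChartAt_symm_comp_mfderiv_extChartAt' (I := 𝓡 (2 * n + 1)) (x := m)
    (mem_extChartAt_source (I := 𝓡 (2 * n + 1)) m)
  rw [ModelWithCorners.range_eq_univ, mfderivWithin_univ] at h
  have h1 := congrArg (fun f => f w) h
  -- The expression evaluates `θ` at the chart inverse of the image of `m`, equal to `m` only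
  -- propositionally; the model space serves as a common type for both tangent spaces.
  have h2 : ∀ m' : M, m' = m → ∀ v : EuclideanSpace ℝ (Fin (2 * n + 1)),
      (θ m' : EuclideanSpace ℝ (Fin (2 * n + 1)) →L[ℝ] ℝ) v
        = (θ m : EuclideanSpace ℝ (Fin (2 * n + 1)) →L[ℝ] ℝ) v := by
    rintro _ rfl v; rfl
  refine (h2 _ (extChartAt_to_inv (I := 𝓡 (2 * n + 1)) m) _).trans ?_
  exact congrArg (θ m) h1

omit [IsManifold (𝓡 (2 * n + 1)) ∞ M] in
lemma IsContactFormOn.differentiableAt {θ : (m : M) → TangentSpace (𝓡 (2 * n + 1)) m →L[ℝ] ℝ}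
    {U : Set M} (h : IsContactFormOn C θ U) {m : M} (hm : m ∈ U) :
    DifferentiableAt ℝ (localExpr θ m) (extChartAt (𝓡 (2 * n + 1)) m m) := by
  have h1 : (extChartAt (𝓡 (2 * n + 1)) m).symm ⁻¹' U ∈ 𝓝 (extChartAt (𝓡 (2 * n + 1)) m m) :=
    (continuousAt_extChartAt_symm (I := 𝓡 (2 * n + 1)) m).preimage_mem_nhds (by
      rw [extChartAt_to_inv]
      exact h.isOpen.mem_nhds hm)
  exact ((h.smooth m).contDiffAt (inter_mem (extChartAt_target_mem_nhds m) h1)).differentiableAt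
    (by simp)

lemma IsContactFormOn.exists_dForm_eq_mul
    {θ θ' : (m : M) → TangentSpace (𝓡 (2 * n + 1)) m →L[ℝ] ℝ} {U U' : Set M}
    (h : IsContactFormOn C θ U) (h' : IsContactFormOn C θ' U') {m : M} (hm : m ∈ U)
    (hm' : m ∈ U') :
    ∃ c : ℝ, c ≠ 0 ∧ ∀ v ∈ C m, ∀ w ∈ C m, dForm θ' m v w = c * dForm θ m v w := by
  have hker : ∀ᶠ y in 𝓝 (extChartAt (𝓡 (2 * n + 1)) m m), ∀ v,
      localExpr θ m y v = 0 ↔ localExpr θ' m y v = 0 := by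
    have h1 : (extChartAt (𝓡 (2 * n + 1)) m).symm ⁻¹' (U ∩ U')
        ∈ 𝓝 (extChartAt (𝓡 (2 * n + 1)) m m) :=
      (continuousAt_extChartAt_symm (I := 𝓡 (2 * n + 1)) m).preimage_mem_nhds (by
        rw [extChartAt_to_inv]
        exact (h.isOpen.inter h'.isOpen).mem_nhds ⟨hm, hm'⟩)
    filter_upwards [h1] with y hy v
    exact (h.mem_iff _ hy.1 _).symm.trans (h'.mem_iff _ hy.2 _)
  have h0 : localExpr θ m (extChartAt (𝓡 (2 * n + 1)) m m) ≠ 0 := by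
    intro h0
    apply h.ne_zero m hm
    ext w
    rw [← localExpr_mfderiv θ m w, h0]
    rfl
  obtain ⟨c, hc, hcvw⟩ := exists_fderiv_eq_mul (h.differentiableAt hm) (h'.differentiableAt hm')
    hker h0
  refine ⟨c, hc, fun v hv w hw => ?_⟩
  have hv' := (localExpr_mfderiv θ m v).trans ((h.mem_iff m hm v).1 hv)
  have hw' := (localExpr_mfderiv θ m w).trans ((h.mem_iff m hm w).1 hw)
  simp only [dForm, LinearMap.mk₂_apply]
  exact (congrArg₂ (· - ·) (hcvw _ _ hw') (hcvw _ _ hv')).trans (mul_sub _ _ _).symm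

/-- Isotropy is stated with one contact form near `m`; proportionality of the differentials on `C m`
transfers it to every other. -/
lemma IsIsotropic.dForm_eq_zero {m : M} {L : Submodule ℝ (TangentSpace (𝓡 (2 * n + 1)) m)}
    (hL : IsIsotropic C m L) {θ : (m : M) → TangentSpace (𝓡 (2 * n + 1)) m →L[ℝ] ℝ} {U : Set M}
    (h : IsContactFormOn C θ U) (hm : m ∈ U) {v w : TangentSpace (𝓡 (2 * n + 1)) m} (hv : v ∈ L)
    (hw : w ∈ L) : dForm θ m v w = 0 := by
  obtain ⟨hLC, U', θ', hm', h', h0⟩ := hL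
  obtain ⟨c, -, hc⟩ := h'.exists_dForm_eq_mul h hm' hm
  rw [hc v (hLC hv) w (hLC hw), h0 v hv w hw, mul_zero]

end ContactForms

/-! ### Coordinates in a symplectic frame. -/

section Frames

variable {n : ℕ} {M : Type*} [TopologicalSpace M]
  [ChartedSpace (EuclideanSpace ℝ (Fin (2 * n + 1))) M] [IsManifold (𝓡 (2 * n + 1)) ∞ M]
  {C : (m : M) → Submodule ℝ (TangentSpace (𝓡 (2 * n + 1)) m)}

open Module

instance (m : M) : FiniteDimensional ℝ (TangentSpace (𝓡 (2 * n + 1)) m) :=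
  inferInstanceAs (FiniteDimensional ℝ (EuclideanSpace ℝ (Fin (2 * n + 1))))

namespace SymplecticFrame

variable (Φ : SymplecticFrame C)

/-- The `2n` fields of a symplectic frame as one family. -/
def vec (k : Fin n ⊕ Fin n) (m : M) : TangentSpace (𝓡 (2 * n + 1)) m :=
  Sum.elim (fun i => Φ.e i m) (fun i => Φ.f i m) k

/-- The coefficients of a vector of `C_m` in the symplectic frame. -/
def coord (m : M) (k : Fin n ⊕ Fin n) : TangentSpace (𝓡 (2 * n + 1)) m →ₗ[ℝ] ℝ :=
  Sum.elim (fun i => (dForm Φ.θ m).flip (Φ.f i m)) (fun i => dForm Φ.θ m (Φ.e i m)) k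

lemma coord_inl (m : M) (i : Fin n) (v : TangentSpace (𝓡 (2 * n + 1)) m) :
    Φ.coord m (Sum.inl i) v = dForm Φ.θ m v (Φ.f i m) := rfl

lemma coord_inr (m : M) (i : Fin n) (v : TangentSpace (𝓡 (2 * n + 1)) m) :
    Φ.coord m (Sum.inr i) v = dForm Φ.θ m (Φ.e i m) v := rfl

variable {Φ} {m : M}

lemma coord_vec (hm : m ∈ Φ.dom) (k l : Fin n ⊕ Fin n) :
    Φ.coord m k (Φ.vec l m) = if k = l then 1 else 0 := by
  rcases k with k | k <;> rcases l with l | l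
  · simp [coord_inl, vec, Φ.e_f l k m hm, eq_comm]
  · simp [coord_inl, vec, Φ.f_f l k m hm]
  · simp [coord_inr, vec, Φ.e_e k l m hm]
  · simp [coord_inr, vec, Φ.e_f k l m hm]

lemma vec_mem (hm : m ∈ Φ.dom) (k : Fin n ⊕ Fin n) : Φ.vec k m ∈ C m := by
  rcases k with k | k
  · exact Φ.e_mem k m hm
  · exact Φ.f_mem k m hm

lemma linearIndependent_vec (hm : m ∈ Φ.dom) : LinearIndependent ℝ fun k => Φ.vec k m := by
  rw [Fintype.linearIndependent_iff]
  intro c hc k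
  have h := congrArg (Φ.coord m k) hc
  simpa only [map_sum, map_smul, coord_vec hm, smul_eq_mul, mul_ite, mul_one, mul_zero,
    Finset.sum_ite_eq, Finset.mem_univ, if_true, map_zero] using h

lemma finrank_distribution (hm : m ∈ Φ.dom) : finrank ℝ (C m) = 2 * n := by
  have h1 : C m = LinearMap.ker (Φ.θ m : TangentSpace (𝓡 (2 * n + 1)) m →ₗ[ℝ] ℝ) := by
    ext v
    exact Φ.contactForm.mem_iff m hm v
  have h2 : LinearMap.range (Φ.θ m : TangentSpace (𝓡 (2 * n + 1)) m →ₗ[ℝ] ℝ) = ⊤ := by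
    refine LinearMap.range_eq_top.2 (LinearMap.surjective ?_)
    intro h
    exact Φ.contactForm.ne_zero m hm (ContinuousLinearMap.coe_injective h)
  have h3 := LinearMap.finrank_range_add_finrank_ker
    (Φ.θ m : TangentSpace (𝓡 (2 * n + 1)) m →ₗ[ℝ] ℝ)
  have h4 : finrank ℝ (TangentSpace (𝓡 (2 * n + 1)) m) = 2 * n + 1 :=
    finrank_euclideanSpace_fin
  rw [h2, finrank_top, finrank_self, ← h1, h4] at h3
  omega

lemma span_vec (hm : m ∈ Φ.dom) : Submodule.span ℝ (Set.range fun k => Φ.vec k m) = C m := by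
  refine Submodule.eq_of_le_of_finrank_eq (Submodule.span_le.2 ?_) ?_
  · rintro _ ⟨k, rfl⟩
    exact vec_mem hm k
  · rw [finrank_span_eq_card (linearIndependent_vec hm), finrank_distribution hm]
    simp [two_mul]

lemma eq_sum_coord (hm : m ∈ Φ.dom) {v : TangentSpace (𝓡 (2 * n + 1)) m} (hv : v ∈ C m) :
    v = ∑ k, Φ.coord m k v • Φ.vec k m := by
  rw [← span_vec hm, Submodule.mem_span_range_iff_exists_fun] at hv
  obtain ⟨c, rfl⟩ := hv
  simp [coord_vec hm]

lemma eq_sum_coord' (hm : m ∈ Φ.dom) {v : TangentSpace (𝓡 (2 * n + 1)) m} (hv : v ∈ C m) :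
    v = ∑ i, Φ.coord m (Sum.inl i) v • Φ.e i m + ∑ i, Φ.coord m (Sum.inr i) v • Φ.f i m := by
  conv_lhs => rw [eq_sum_coord hm hv, Fintype.sum_sum_type]
  rfl

lemma isSmoothFieldAt_vec (hm : m ∈ Φ.dom) (k : Fin n ⊕ Fin n) : IsSmoothFieldAt (Φ.vec k) m := by
  rcases k with k | k
  · exact (Φ.smooth_e k).at Φ.contactForm.isOpen hm
  · exact (Φ.smooth_f k).at Φ.contactForm.isOpen hm

/-- The form `dForm` is computed at each point in that point's own chart, so smoothness is not read
off from its definition. It follows instead from these numbers being the coefficients of `X` in a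
smooth independent family. -/
lemma contMDiffAt_coord (hm : m ∈ Φ.dom) {X : (m : M) → TangentSpace (𝓡 (2 * n + 1)) m}
    (hX : IsSmoothFieldAt X m) (hXC : ∀ᶠ m' in 𝓝 m, X m' ∈ C m') (k : Fin n ⊕ Fin n) :
    ContMDiffAt (𝓡 (2 * n + 1)) 𝓘(ℝ, ℝ) ∞ (fun m' => Φ.coord m' k (X m')) m := by
  refine contMDiffAt_coeff (isSmoothFieldAt_vec hm) (linearIndependent_vec hm) hX
    (z := fun k m' => Φ.coord m' k (X m')) ?_ k
  filter_upwards [hXC, Φ.contactForm.isOpen.mem_nhds hm] with m' h1 h2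
  exact eq_sum_coord h2 h1

lemma dForm_eq_sum (hm : m ∈ Φ.dom) {v w : TangentSpace (𝓡 (2 * n + 1)) m} (hv : v ∈ C m) :
    dForm Φ.θ m v w = ∑ i, (Φ.coord m (Sum.inl i) v * Φ.coord m (Sum.inr i) w
      - Φ.coord m (Sum.inr i) v * Φ.coord m (Sum.inl i) w) := by
  conv_lhs => rw [eq_sum_coord' hm hv]
  simp only [map_add, map_sum, map_smul, LinearMap.add_apply, LinearMap.sum_apply,
    LinearMap.smul_apply, smul_eq_mul, coord_inl, coord_inr]
  rw [Finset.sum_sub_distrib, sub_eq_add_neg, ← Finset.sum_neg_distrib]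
  congr 1
  refine Finset.sum_congr rfl fun i _ => ?_
  rw [dForm_swap Φ.θ m (Φ.f i m) w, mul_neg]

lemma w_mem (hm : m ∈ Φ.dom) (p : Sym2 (Fin n) → ℝ) (i : Fin n) : Φ.w m p i ∈ C m :=
  add_mem (Φ.e_mem i m hm) (sum_mem fun j _ => Submodule.smul_mem _ _ (Φ.f_mem j m hm))

lemma coord_inl_w (hm : m ∈ Φ.dom) (p : Sym2 (Fin n) → ℝ) (i k : Fin n) :
    Φ.coord m (Sum.inl k) (Φ.w m p i) = if i = k then 1 else 0 := by
  rw [coord_inl, Φ.dForm_w_f hm]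

lemma coord_inr_w (hm : m ∈ Φ.dom) (p : Sym2 (Fin n) → ℝ) (i k : Fin n) :
    Φ.coord m (Sum.inr k) (Φ.w m p i) = p s(i, k) := by
  simp [coord_inr, w, Φ.e_e k i m hm, Φ.e_f k _ m hm]

/-- The point of `L_P` with given coefficients. -/
lemma mem_plane_point_iff (hm : m ∈ Φ.dom) (p : Sym2 (Fin n) → ℝ)
    (v : TangentSpace (𝓡 (2 * n + 1)) m) :
    v ∈ (Φ.point m hm p).plane ↔ ∃ c : Fin n → ℝ, ∑ i, c i • Φ.w m p i = v :=
  Submodule.mem_span_range_iff_exists_fun ℝ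

lemma w_mem_plane (hm : m ∈ Φ.dom) (p : Sym2 (Fin n) → ℝ) (i : Fin n) :
    Φ.w m p i ∈ (Φ.point m hm p).plane :=
  (Submodule.subset_span ⟨i, rfl⟩ : Φ.w m p i ∈ Submodule.span ℝ (Set.range (Φ.w m p)))

lemma coord_inl_sum_w (hm : m ∈ Φ.dom) (p : Sym2 (Fin n) → ℝ) (c : Fin n → ℝ) (k : Fin n) :
    Φ.coord m (Sum.inl k) (∑ i, c i • Φ.w m p i) = c k := by
  simp [coord_inl_w hm]

lemma coord_inr_sum_w (hm : m ∈ Φ.dom) (p : Sym2 (Fin n) → ℝ) (c : Fin n → ℝ) (k : Fin n) :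
    Φ.coord m (Sum.inr k) (∑ i, c i • Φ.w m p i) = ∑ i, c i * p s(i, k) := by
  simp [coord_inr_w hm]

/-- Vectors of `C_m` are determined by their coefficients. -/
lemma eq_of_coord (hm : m ∈ Φ.dom) {v w : TangentSpace (𝓡 (2 * n + 1)) m} (hv : v ∈ C m)
    (hw : w ∈ C m) (h1 : ∀ k, Φ.coord m (Sum.inl k) v = Φ.coord m (Sum.inl k) w)
    (h2 : ∀ k, Φ.coord m (Sum.inr k) v = Φ.coord m (Sum.inr k) w) : v = w := by
  rw [eq_sum_coord' hm hv, eq_sum_coord' hm hw]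
  simp_rw [h1, h2]

end SymplecticFrame

/-! ### Transition maps between the standard charts of the prolongation. -/

section Transition

/-- The symmetric part of a matrix. -/
def symPart (Q : Matrix (Fin n) (Fin n) ℝ) : Sym2 (Fin n) → ℝ :=
  fun s => Sym2.lift ⟨fun i j => (Q i j + Q j i) / 2, fun i j => by
    change (Q i j + Q j i) / 2 = (Q j i + Q i j) / 2
    rw [add_comm]⟩ s

lemma symPart_mk (Q : Matrix (Fin n) (Fin n) ℝ) (i j : Fin n) :
    symPart Q s(i, j) = (Q i j + Q j i) / 2 := rfl

lemma symMat_symPart {Q : Matrix (Fin n) (Fin n) ℝ} (hQ : Q.transpose = Q) :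
    symMat (symPart Q) = Q := by
  ext i j
  have : Q j i = Q i j := congrFun (congrFun hQ i) j
  rw [symMat_apply, symPart_mk, this, add_self_div_two]

lemma symPart_symMat (p : Sym2 (Fin n) → ℝ) : symPart (symMat p) = p := by
  funext s
  induction s with
  | _ i j => rw [symPart_mk, symMat_apply, symMat_apply, Sym2.eq_swap (a := j), add_self_div_two]

namespace SymplecticFrame

variable (Φ Φ' : SymplecticFrame C)

/-- The `e`-coefficients of the vectors `w'_i` of a second frame. -/
def transE (q : M × (Sym2 (Fin n) → ℝ)) : Matrix (Fin n) (Fin n) ℝ :=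
  Matrix.of fun i k => Φ.coord q.1 (Sum.inl k) (Φ'.w q.1 q.2 i)

/-- The `f`-coefficients of the vectors `w'_i` of a second frame. -/
def transF (q : M × (Sym2 (Fin n) → ℝ)) : Matrix (Fin n) (Fin n) ℝ :=
  Matrix.of fun i k => Φ.coord q.1 (Sum.inr k) (Φ'.w q.1 q.2 i)

/-- The transition from the coordinates of `Φ'` to those of `Φ`. -/
def trans (q : M × (Sym2 (Fin n) → ℝ)) : Sym2 (Fin n) → ℝ :=
  symPart ((Φ.transE Φ' q)⁻¹ * Φ.transF Φ' q)

variable {Φ Φ'} {m : M}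

/-- If the rows of `(A | B)` span the plane and `A` is invertible, so do the rows of `(1 | A⁻¹B)`.
Isotropy says `A Bᵀ = B Aᵀ`, so `A⁻¹B` is symmetric and taking its symmetric part loses nothing. -/
lemma point_trans (h : m ∈ Φ.dom) (h' : m ∈ Φ'.dom) {p : Sym2 (Fin n) → ℝ}
    (hdet : (Φ.transE Φ' (m, p)).det ≠ 0) :
    Φ.point m h (Φ.trans Φ' (m, p)) = Φ'.point m h' p := by
  set A := Φ.transE Φ' (m, p) with hA
  set B := Φ.transF Φ' (m, p) with hB
  have hu : IsUnit A.det := isUnit_iff_ne_zero.2 hdet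
  have hsymm : A * B.transpose = B * A.transpose := by
    ext i k
    have h0 : dForm Φ.θ m (Φ'.w m p i) (Φ'.w m p k) = 0 :=
      (Φ'.point m h' p).isotropic.dForm_eq_zero Φ.contactForm h
        (w_mem_plane h' p i) (w_mem_plane h' p k)
    rw [dForm_eq_sum h (w_mem h' p i), Finset.sum_sub_distrib, sub_eq_zero] at h0
    simpa [Matrix.mul_apply, hA, hB, transE, transF] using h0
  have hQ : (A⁻¹ * B).transpose = A⁻¹ * B := by
    have hu' : IsUnit A.transpose.det := by rwa [Matrix.det_transpose]
    rw [Matrix.transpose_mul, Matrix.transpose_nonsing_inv]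
    calc B.transpose * A.transpose⁻¹ = A⁻¹ * (A * B.transpose) * A.transpose⁻¹ := by
          rw [← Matrix.mul_assoc, Matrix.nonsing_inv_mul _ hu, Matrix.one_mul]
      _ = A⁻¹ * B := by
          rw [hsymm, Matrix.mul_assoc, Matrix.mul_assoc, Matrix.mul_nonsing_inv _ hu',
            Matrix.mul_one]
  have hP : A * symMat (Φ.trans Φ' (m, p)) = B := by
    rw [trans, symMat_symPart hQ, ← Matrix.mul_assoc, Matrix.mul_nonsing_inv _ hu, Matrix.one_mul]
  have hle : Submodule.span ℝ (Set.range (Φ'.w m p)) ≤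
      Submodule.span ℝ (Set.range (Φ.w m (Φ.trans Φ' (m, p)))) := by
    refine Submodule.span_le.2 ?_
    rintro _ ⟨i, rfl⟩
    refine (mem_plane_point_iff h _ _).2 ⟨A i, eq_of_coord h ?_ (w_mem h' p i) ?_ ?_⟩
    · exact sum_mem fun j _ => Submodule.smul_mem _ _ (w_mem h _ j)
    · intro k
      rw [coord_inl_sum_w h]
      rfl
    · intro k
      rw [coord_inr_sum_w h]
      exact congrFun (congrFun hP i) k
  refine Prolongation.ext rfl (Submodule.eq_of_le_of_finrank_eq hle ?_).symm
  rw [finrank_span_eq_card (Φ'.linearIndependent_w h' p),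
    finrank_span_eq_card (Φ.linearIndependent_w h _)]

/-- The matrix `transE` expresses one basis `w'` of the common plane in the other basis `w`, hence
is invertible; comparing `f`-coefficients then gives `B = A P`. -/
lemma trans_of_point_eq (h : m ∈ Φ.dom) (h' : m ∈ Φ'.dom) {p p' : Sym2 (Fin n) → ℝ}
    (heq : Φ.point m h p = Φ'.point m h' p') :
    (Φ.transE Φ' (m, p')).det ≠ 0 ∧ Φ.trans Φ' (m, p') = p := by
  have hplane : (Φ.point m h p).plane = (Φ'.point m h' p').plane := by
    have h1 : ∀ x y : Prolongation C, x = y → HEq x.plane y.plane := by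
      rintro x _ rfl; rfl
    exact eq_of_heq (h1 _ _ heq)
  have hw : ∀ i, ∑ k, Φ.transE Φ' (m, p') i k • Φ.w m p k = Φ'.w m p' i := by
    intro i
    have : Φ'.w m p' i ∈ (Φ.point m h p).plane := by
      rw [hplane]
      exact w_mem_plane h' p' i
    obtain ⟨c, hc⟩ := (mem_plane_point_iff h p _).1 this
    rw [← hc]
    refine Finset.sum_congr rfl fun k _ => ?_
    have : Φ.transE Φ' (m, p') i k = c k := by
      rw [transE, Matrix.of_apply, ← hc, coord_inl_sum_w h]
    rw [this]
  have hdet : (Φ.transE Φ' (m, p')).det ≠ 0 := by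
    intro h0
    obtain ⟨x, hx, hx0⟩ := Matrix.exists_vecMul_eq_zero_iff.2 h0
    apply hx
    have hind := Φ'.linearIndependent_w h' p'
    rw [Fintype.linearIndependent_iff] at hind
    funext i
    refine hind x ?_ i
    simp_rw [← hw, Finset.smul_sum, smul_smul]
    rw [Finset.sum_comm]
    refine Finset.sum_eq_zero fun k _ => ?_
    rw [← Finset.sum_smul]
    have : ∑ i, x i * Φ.transE Φ' (m, p') i k = 0 := congrFun hx0 k
    rw [this, zero_smul]
  refine ⟨hdet, ?_⟩
  have hB : Φ.transF Φ' (m, p') = Φ.transE Φ' (m, p') * symMat p := by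
    ext i k
    rw [transF, Matrix.of_apply]
    simp only
    rw [← hw, coord_inr_sum_w h]
    rfl
  rw [trans, hB, ← Matrix.mul_assoc, Matrix.nonsing_inv_mul _ (isUnit_iff_ne_zero.2 hdet),
    Matrix.one_mul, symPart_symMat]

lemma contMDiffAt_coord_w (h : m ∈ Φ.dom) (h' : m ∈ Φ'.dom) (p : Sym2 (Fin n) → ℝ) (i : Fin n)
    (k : Fin n ⊕ Fin n) :
    ContMDiffAt ((𝓡 (2 * n + 1)).prod 𝓘(ℝ, Sym2 (Fin n) → ℝ)) 𝓘(ℝ, ℝ) ∞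
      (fun q : M × (Sym2 (Fin n) → ℝ) => Φ.coord q.1 k (Φ'.w q.1 q.2 i)) (m, p) := by
  have hfun : (fun q : M × (Sym2 (Fin n) → ℝ) => Φ.coord q.1 k (Φ'.w q.1 q.2 i)) = fun q =>
      Φ.coord q.1 k (Φ'.e i q.1) + ∑ j, q.2 s(i, j) * Φ.coord q.1 k (Φ'.f j q.1) := by
    funext q
    simp [w]
  have hfst : ContMDiffAt ((𝓡 (2 * n + 1)).prod 𝓘(ℝ, Sym2 (Fin n) → ℝ)) (𝓡 (2 * n + 1)) ∞
      (Prod.fst : M × (Sym2 (Fin n) → ℝ) → M) (m, p) := contMDiffAt_fst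
  have hsnd : ContMDiffAt ((𝓡 (2 * n + 1)).prod 𝓘(ℝ, Sym2 (Fin n) → ℝ))
      𝓘(ℝ, Sym2 (Fin n) → ℝ) ∞ (Prod.snd : M × (Sym2 (Fin n) → ℝ) → _) (m, p) := contMDiffAt_snd
  have hopen := Φ'.contactForm.isOpen.mem_nhds h'
  have hE := contMDiffAt_coord h ((Φ'.smooth_e i).at Φ'.contactForm.isOpen h')
    (by filter_upwards [hopen] with m' hm'; exact Φ'.e_mem i m' hm') k
  have hF := fun j => contMDiffAt_coord h ((Φ'.smooth_f j).at Φ'.contactForm.isOpen h')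
    (by filter_upwards [hopen] with m' hm'; exact Φ'.f_mem j m' hm') k
  rw [hfun]
  refine ContMDiffAt.add (ContMDiffAt.comp (m, p) (g := fun m' => Φ.coord m' k (Φ'.e i m')) hE hfst)
    (contMDiffAt_finsetSum fun j _ => ContMDiffAt.mul (contMDiffAt_pi_space.1 hsnd s(i, j)) ?_)
  exact ContMDiffAt.comp (m, p) (g := fun m' => Φ.coord m' k (Φ'.f j m')) (hF j) hfst

lemma contMDiffAt_trans (h : m ∈ Φ.dom) (h' : m ∈ Φ'.dom) {p : Sym2 (Fin n) → ℝ}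
    (hdet : (Φ.transE Φ' (m, p)).det ≠ 0) :
    ContMDiffAt ((𝓡 (2 * n + 1)).prod 𝓘(ℝ, Sym2 (Fin n) → ℝ)) 𝓘(ℝ, Sym2 (Fin n) → ℝ) ∞
      (Φ.trans Φ') (m, p) := by
  have hE : ∀ i k, ContMDiffAt ((𝓡 (2 * n + 1)).prod 𝓘(ℝ, Sym2 (Fin n) → ℝ)) 𝓘(ℝ, ℝ) ∞
      (fun q => Φ.transE Φ' q i k) (m, p) := fun i k => contMDiffAt_coord_w h h' p i (Sum.inl k)
  have hF : ∀ i k, ContMDiffAt ((𝓡 (2 * n + 1)).prod 𝓘(ℝ, Sym2 (Fin n) → ℝ)) 𝓘(ℝ, ℝ) ∞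
      (fun q => Φ.transF Φ' q i k) (m, p) := fun i k => contMDiffAt_coord_w h h' p i (Sum.inr k)
  have hQ : ∀ i k, ContMDiffAt ((𝓡 (2 * n + 1)).prod 𝓘(ℝ, Sym2 (Fin n) → ℝ)) 𝓘(ℝ, ℝ) ∞
      (fun q => ((Φ.transE Φ' q)⁻¹ * Φ.transF Φ' q) i k) (m, p) := by
    intro i k
    simp_rw [Matrix.mul_apply]
    exact contMDiffAt_finsetSum fun j _ => (contMDiffAt_inv_apply hE hdet i j).mul (hF j k)
  refine contMDiffAt_pi_space.2 fun s => ?_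
  induction s with
  | _ i j =>
    have hd : ContDiff ℝ ∞ (fun t : ℝ => t / 2) := by fun_prop
    exact hd.contMDiff.contMDiffAt.comp (m, p) ((hQ i j).add (hQ j i))

lemma eventually_transE_ne_zero (h : m ∈ Φ.dom) (h' : m ∈ Φ'.dom) {p : Sym2 (Fin n) → ℝ}
    (hdet : (Φ.transE Φ' (m, p)).det ≠ 0) :
    ∀ᶠ q in 𝓝 (m, p), (Φ.transE Φ' q).det ≠ 0 :=
  (contMDiffAt_det (A := Φ.transE Φ')
    fun i k => contMDiffAt_coord_w h h' p i (Sum.inl k)).continuousAt.eventually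
    (isOpen_ne.mem_nhds hdet)

/-- The standard charts of `M⁽¹⁾` have open images. -/
lemma isOpen_image (Φ : SymplecticFrame C) {W : Set (M × (Sym2 (Fin n) → ℝ))} (hW : IsOpen W) :
    IsOpen {y : Prolongation C | ∃ q ∈ W, ∃ h : q.1 ∈ Φ.dom, Φ.point q.1 h q.2 = y} := by
  intro Φ'
  rw [isOpen_iff_mem_nhds]
  rintro ⟨m, p'⟩ ⟨h', ⟨m₁, p⟩, hq, h, heq⟩
  obtain rfl : m₁ = m := congrArg Prolongation.base heq
  obtain ⟨hdet, htr⟩ := trans_of_point_eq h h' heq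
  have hcont : ContinuousAt (fun q : M × (Sym2 (Fin n) → ℝ) => (q.1, Φ.trans Φ' q)) (m₁, p') :=
    continuousAt_fst.prodMk (contMDiffAt_trans h h' hdet).continuousAt
  have h1 : ∀ᶠ q in 𝓝 (m₁, p'), (q.1, Φ.trans Φ' q) ∈ W :=
    hcont.eventually (hW.mem_nhds (by simpa only [htr] using hq))
  have h2 : ∀ᶠ q : M × (Sym2 (Fin n) → ℝ) in 𝓝 (m₁, p'), q.1 ∈ Φ.dom :=
    continuousAt_fst.eventually (Φ.contactForm.isOpen.mem_nhds h)
  have h3 : ∀ᶠ q : M × (Sym2 (Fin n) → ℝ) in 𝓝 (m₁, p'), q.1 ∈ Φ'.dom :=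
    continuousAt_fst.eventually (Φ'.contactForm.isOpen.mem_nhds h')
  filter_upwards [h1, h2, h3, eventually_transE_ne_zero h h' hdet] with q hq1 hq2 hq3 hq4
  exact ⟨hq3, _, hq1, hq2, point_trans hq2 hq3 hq4⟩

end SymplecticFrame

end Transition

end Frames

/-! ### Metric, subspaces and equation in a chart. -/

section LocalForm

variable {n : ℕ} {M : Type*} [TopologicalSpace M]
  [ChartedSpace (EuclideanSpace ℝ (Fin (2 * n + 1))) M] [IsManifold (𝓡 (2 * n + 1)) ∞ M]
  {C : (m : M) → Submodule ℝ (TangentSpace (𝓡 (2 * n + 1)) m)}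

open Module

namespace SymplecticFrame

variable {Φ : SymplecticFrame C} {m : M}

/-- The `e`-coefficients of a tangent vector. -/
def coordE (Φ : SymplecticFrame C) (m : M) : TangentSpace (𝓡 (2 * n + 1)) m →ₗ[ℝ] (Fin n → ℝ) :=
  LinearMap.pi fun i => Φ.coord m (Sum.inl i)

lemma coordE_sum_w (hm : m ∈ Φ.dom) (p : Sym2 (Fin n) → ℝ) (c : Fin n → ℝ) :
    Φ.coordE m (∑ i, c i • Φ.w m p i) = c :=
  funext fun k => coord_inl_sum_w hm p c k

lemma coordE_w (hm : m ∈ Φ.dom) (p : Sym2 (Fin n) → ℝ) (i : Fin n) :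
    Φ.coordE m (Φ.w m p i) = Pi.single i 1 := by
  funext k
  rw [coordE, LinearMap.pi_apply, coord_inl_w hm, Pi.single_apply]
  simp [eq_comm]

/-- The pairing of a symmetric contravariant tensor with the form of matrix `h`. -/
def pairing (Φ : SymplecticFrame C) (m : M) (h : Sym2 (Fin n) → ℝ) :
    TangentSpace (𝓡 (2 * n + 1)) m ⊗[ℝ] TangentSpace (𝓡 (2 * n + 1)) m →ₗ[ℝ] ℝ :=
  TensorProduct.lift ((Matrix.toBilin' (symMat h)).compl₁₂ (Φ.coordE m) (Φ.coordE m))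

lemma pairing_symProd (h : Sym2 (Fin n) → ℝ) (v w : TangentSpace (𝓡 (2 * n + 1)) m) :
    Φ.pairing m h (symProd v w) = Φ.coordE m v ⬝ᵥ (symMat h).mulVec (Φ.coordE m w) := by
  simp only [pairing, symProd, map_smul, map_add, TensorProduct.lift.tmul,
    LinearMap.compl₁₂_apply, Matrix.toBilin'_apply', smul_eq_mul]
  rw [symm_symMat h (Φ.coordE m w)]
  ring

/-- The form `h` pairs with `w_i ∨ w_j` to `h_{ij}`, so the metric pairs with `h` to the derivative
of `F` along the fibre in the direction `h`. -/
lemma pairing_metric (hm : m ∈ Φ.dom) (F : M × (Sym2 (Fin n) → ℝ) → ℝ) (p h : Sym2 (Fin n) → ℝ) :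
    Φ.pairing m h (Φ.metric F m p) = fderiv ℝ (fun p' => F (m, p')) p h := by
  have hw : ∀ s : Sym2 (Fin n), Φ.pairing m h (Sym2.lift ⟨fun i j => symProd (Φ.w m p i) (Φ.w m p j),
      fun _ _ => symProd_comm _ _⟩ s) = h s := by
    intro s
    induction s with
    | _ i j =>
      rw [Sym2.lift_mk, pairing_symProd, coordE_w hm, coordE_w hm]
      simp [symMat_apply]
  simp only [metric, map_sum, map_smul, hw, smul_eq_mul]
  conv_rhs => rw [pi_eq_sum_univ h, map_sum]
  refine Finset.sum_congr rfl fun s _ => ?_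
  rw [map_smul, smul_eq_mul, mul_comm]
  congr 2
  funext t
  simp [Pi.single_apply, eq_comm]

/-- The derivative of `F` along the fibre is given by the decomposed metric. -/
lemma fderiv_eq_of_metric (hm : m ∈ Φ.dom) {F : M × (Sym2 (Fin n) → ℝ) → ℝ} {p : Sym2 (Fin n) → ℝ}
    {c c' : Fin n → ℝ}
    (h : Φ.metric F m p = symProd (∑ i, c i • Φ.w m p i) (∑ i, c' i • Φ.w m p i))
    (k : Sym2 (Fin n) → ℝ) :
    fderiv ℝ (fun p' => F (m, p')) p k = c ⬝ᵥ (symMat k).mulVec c' := by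
  rw [← pairing_metric hm, h, pairing_symProd, coordE_sum_w hm, coordE_sum_w hm]

/-- The vector with given coefficients in the symplectic frame. -/
def ofCoord (Φ : SymplecticFrame C) (m : M) :
    EuclideanSpace ℝ (Fin n ⊕ Fin n) →ₗ[ℝ] TangentSpace (𝓡 (2 * n + 1)) m :=
  Fintype.linearCombination ℝ (fun k => Φ.vec k m) ∘ₗ (WithLp.linearEquiv 2 ℝ _).toLinearMap

lemma ofCoord_apply (x : EuclideanSpace ℝ (Fin n ⊕ Fin n)) :
    Φ.ofCoord m x = ∑ k, x k • Φ.vec k m := rfl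

lemma coord_ofCoord (hm : m ∈ Φ.dom) (x : EuclideanSpace ℝ (Fin n ⊕ Fin n)) (k : Fin n ⊕ Fin n) :
    Φ.coord m k (Φ.ofCoord m x) = x k := by
  simp only [ofCoord_apply, map_sum, map_smul, coord_vec hm, smul_eq_mul, mul_ite, mul_one,
    mul_zero, Finset.sum_ite_eq, Finset.mem_univ, if_true]

lemma ofCoord_mem (hm : m ∈ Φ.dom) (x : EuclideanSpace ℝ (Fin n ⊕ Fin n)) : Φ.ofCoord m x ∈ C m := by
  rw [ofCoord_apply]
  exact sum_mem fun k _ => Submodule.smul_mem _ _ (vec_mem hm k)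

lemma ofCoord_injective (hm : m ∈ Φ.dom) : Function.Injective (Φ.ofCoord m) := by
  intro x y hxy
  ext k
  rw [← coord_ofCoord hm x, hxy, coord_ofCoord hm]

/-- A basis of an `n`-dimensional subspace of `C_m` with orthonormal coefficients. -/
lemma exists_orthonormal_coord (hm : m ∈ Φ.dom) {D : Submodule ℝ (TangentSpace (𝓡 (2 * n + 1)) m)}
    (hD : D ≤ C m) (hn : finrank ℝ D = n) :
    ∃ d : Fin n → EuclideanSpace ℝ (Fin n ⊕ Fin n), Orthonormal ℝ d ∧
      Submodule.span ℝ (Set.range fun i => Φ.ofCoord m (d i)) = D := by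
  have hrange : D ≤ LinearMap.range (Φ.ofCoord m) := by
    intro v hv
    exact ⟨WithLp.toLp 2 fun k => Φ.coord m k v, (eq_sum_coord hm (hD hv)).symm⟩
  have hmap : (D.comap (Φ.ofCoord m)).map (Φ.ofCoord m) = D := by
    rw [Submodule.map_comap_eq, inf_eq_right.2 hrange]
  have hfin : finrank ℝ (D.comap (Φ.ofCoord m)) = n := by
    have := (Submodule.equivMapOfInjective _ (ofCoord_injective (Φ := Φ) hm)
      (D.comap (Φ.ofCoord m))).finrank_eq
    rw [this, hmap, hn]
  set b := (stdOrthonormalBasis ℝ (D.comap (Φ.ofCoord m))).reindex (finCongr hfin) with hb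
  refine ⟨fun i => b i, ?_, ?_⟩
  · exact b.orthonormal.comp_linearIsometry (D.comap (Φ.ofCoord m)).subtypeₗᵢ
  · have h1 : Submodule.span ℝ (Set.range fun i => (b i : EuclideanSpace ℝ (Fin n ⊕ Fin n)))
        = D.comap (Φ.ofCoord m) := by
      have := congrArg (Submodule.map (D.comap (Φ.ofCoord m)).subtype) b.toBasis.span_eq
      rw [Submodule.map_span, ← Set.range_comp, Submodule.map_top, Submodule.range_subtype] at this
      simpa [Function.comp_def] using this
    have h2 := congrArg (Submodule.map (Φ.ofCoord m)) h1
    rw [hmap, Submodule.map_span, ← Set.range_comp] at h2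
    exact h2

/-- The planes `L_P` which meet an `n`-dimensional subspace of `C_m` are given by a determinant. -/
lemma exists_matrices (hm : m ∈ Φ.dom) {D : Submodule ℝ (TangentSpace (𝓡 (2 * n + 1)) m)}
    (hD : D ≤ C m) (hn : finrank ℝ D = n) :
    ∃ A B : Matrix (Fin n) (Fin n) ℝ, A * A.transpose + B * B.transpose = 1 ∧
      ∀ p, (∃ v ∈ (Φ.point m hm p).plane, v ∈ D ∧ v ≠ 0) ↔ (B - A * symMat p).det = 0 := by
  obtain ⟨d, hd, hspan⟩ := exists_orthonormal_coord hm hD hn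
  refine ⟨Matrix.of fun i k => d i (Sum.inl k), Matrix.of fun i k => d i (Sum.inr k), ?_, ?_⟩
  · ext i j
    have h := orthonormal_iff_ite.1 hd i j
    rw [PiLp.inner_apply, Fintype.sum_sum_type] at h
    simpa [Matrix.mul_apply, Matrix.one_apply, mul_comm] using h
  intro p
  have hmemD : ∀ v, v ∈ D ↔ ∃ y : Fin n → ℝ, Φ.ofCoord m (∑ i, y i • d i) = v := by
    intro v
    rw [← hspan, Submodule.mem_span_range_iff_exists_fun]
    simp only [map_sum, map_smul]
  have hdy : ∀ (y : Fin n → ℝ) k, (∑ i, y i • d i) k = ∑ i, y i * d i k := by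
    intro y k
    simp
  -- The combination with coefficients `y` has `e`-part `yA` and `f`-part `yB`; belonging to `L_P`
  -- means `yB = yAP`.
  have heq : ∀ y : Fin n → ℝ, Matrix.vecMul y ((Matrix.of fun i k => d i (Sum.inr k)) -
      (Matrix.of fun i k => d i (Sum.inl k)) * symMat p) = 0 ↔ ∀ k,
      ∑ i, y i * d i (Sum.inr k) = ∑ j, (∑ i, y i * d i (Sum.inl j)) * p s(j, k) := by
    intro y
    rw [Matrix.vecMul_sub, ← Matrix.vecMul_vecMul, sub_eq_zero, funext_iff]
    rfl
  rw [← Matrix.exists_vecMul_eq_zero_iff]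
  constructor
  · rintro ⟨v, hv, hvD, hv0⟩
    obtain ⟨y, rfl⟩ := (hmemD v).1 hvD
    obtain ⟨c, hc⟩ := (mem_plane_point_iff hm p _).1 hv
    refine ⟨y, ?_, (heq y).2 fun k => ?_⟩
    · rintro rfl
      exact hv0 ((congrArg (Φ.ofCoord m) (Finset.sum_eq_zero fun i _ => zero_smul ℝ _)).trans
        (map_zero _))
    have h1 : ∀ k, ∑ i, y i * d i (Sum.inl k) = c k := fun k => by
      rw [← hdy, ← coord_ofCoord hm, ← hc, coord_inl_sum_w hm]
    simp_rw [h1]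
    rw [← hdy, ← coord_ofCoord hm, ← hc, coord_inr_sum_w hm]
  · rintro ⟨y, hy, hy0⟩
    rw [heq] at hy0
    refine ⟨Φ.ofCoord m (∑ i, y i • d i), ?_, (hmemD _).2 ⟨y, rfl⟩, ?_⟩
    · refine (mem_plane_point_iff hm p _).2 ⟨fun j => ∑ i, y i * d i (Sum.inl j), ?_⟩
      refine eq_of_coord hm (sum_mem fun i _ => Submodule.smul_mem _ _ (w_mem hm p i))
        (ofCoord_mem hm _) (fun k => ?_) (fun k => ?_)
      · rw [coord_inl_sum_w hm, coord_ofCoord hm, hdy]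
      · rw [coord_inr_sum_w hm, coord_ofCoord hm, hdy, hy0]
    · intro h0
      apply hy
      have h1 : ∑ i, y i • d i = 0 := ofCoord_injective (Φ := Φ) hm (h0.trans (map_zero _).symm)
      have h2 := hd.linearIndependent
      rw [Fintype.linearIndependent_iff] at h2
      exact funext (h2 y h1)

end SymplecticFrame

/-! ### Local coincidence of `E` with `E_D`. -/

section Filling

variable {E : Set (Prolongation C)}
  {ℓ ℓ' : (x : Prolongation C) → Submodule ℝ (TangentSpace (𝓡 (2 * n + 1)) x.base)}
  {D : (m : M) → Submodule ℝ (TangentSpace (𝓡 (2 * n + 1)) m)}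

lemma MetricDecomposes.symm {x : Prolongation C}
    {l l' : Submodule ℝ (TangentSpace (𝓡 (2 * n + 1)) x.base)} (h : MetricDecomposes E x l l') :
    MetricDecomposes E x l' l := by
  obtain ⟨v, hv, v', hv', h0, h0', hl, hl', Φ, W, F, hd, p, h1, h2, h3, h4⟩ := h
  exact ⟨v', hv', v, hv, h0', h0, hl', hl, Φ, W, F, hd, p, h1, h2, h3, by rw [h4, symProd_comm]⟩

lemma MetricDecomposes.le_plane {x : Prolongation C}
    {l l' : Submodule ℝ (TangentSpace (𝓡 (2 * n + 1)) x.base)} (h : MetricDecomposes E x l l') :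
    l ≤ x.plane := by
  obtain ⟨v, hv, v', -, -, -, rfl, -⟩ := h
  rwa [Submodule.span_singleton_le_iff_mem]

omit [IsManifold (𝓡 (2 * n + 1)) ∞ M] in
lemma Fill.line_le (hD : Fill E ℓ D) {x : Prolongation C} (hx : x ∈ E) : ℓ x ≤ D x.base := by
  intro u hu
  rw [(hD x.base ⟨x, hx, rfl⟩).2]
  exact Submodule.subset_span ⟨x, hx, u, hu, rfl⟩

lemma Fill.le_distribution (hD : Fill E ℓ D) (hg : ∀ x ∈ E, MetricDecomposes E x (ℓ x) (ℓ' x))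
    {m : M} (hm : ∃ x ∈ E, x.base = m) : D m ≤ C m := by
  rw [(hD m hm).2, Submodule.span_le]
  rintro v ⟨x, hx, u, hu, heq⟩
  cases heq
  exact x.isotropic.1 ((hg x hx).le_plane hu)

/-- The points of the equation lie in `E_D`. -/
lemma Fill.exists_mem (hD : Fill E ℓ D) (hg : ∀ x ∈ E, MetricDecomposes E x (ℓ x) (ℓ' x))
    {x : Prolongation C} (hx : x ∈ E) : ∃ v ∈ x.plane, v ∈ D x.base ∧ v ≠ 0 := by
  have hl := hD.line_le hx
  obtain ⟨v, hv, v', -, h0, -, hl', -⟩ := hg x hx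
  exact ⟨v, hv, hl (by rw [hl']; exact Submodule.mem_span_singleton_self v), h0⟩

omit [IsManifold (𝓡 (2 * n + 1)) ∞ M] in
lemma mem_equationOf_iff {x : Prolongation C} :
    x ∈ equationOf C D ↔ ∃ v ∈ x.plane, v ∈ D x.base ∧ v ≠ 0 := by
  refine (Submodule.ne_bot_iff _).trans ?_
  simp only [Submodule.mem_inf, and_assoc]

/-- In a chart of `M⁽¹⁾` around a point of `E`, the data of the equation with decomposable metric. -/
lemma MetricDecomposes.exists_chart {x : Prolongation C}
    {l l' : Submodule ℝ (TangentSpace (𝓡 (2 * n + 1)) x.base)} (hx : x ∈ E)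
    (h : MetricDecomposes E x l l') :
    ∃ (Φ : SymplecticFrame C) (W : Set (M × (Sym2 (Fin n) → ℝ))) (F : M × (Sym2 (Fin n) → ℝ) → ℝ)
      (m : M) (hm : m ∈ Φ.dom) (p : Sym2 (Fin n) → ℝ) (c c' : Fin n → ℝ),
      x = Φ.point m hm p ∧ IsLocalEquation Φ E W F ∧ (m, p) ∈ W ∧ F (m, p) = 0 ∧ c ≠ 0 ∧ c' ≠ 0 ∧
      ∀ k, fderiv ℝ (fun p' => F (m, p')) p k = c ⬝ᵥ (symMat k).mulVec c' := by
  obtain ⟨v, hv, v', hv', h0, h0', -, -, Φ, W, F, hd, p, h1, h2, h3, h4⟩ := h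
  -- Replacing `x` by a chart point makes its base reduce to `m`, so that vectors of its plane have
  -- the expected type.
  obtain ⟨m, hm, rfl⟩ : ∃ m, ∃ hm : m ∈ Φ.dom, x = Φ.point m hm p := ⟨_, hd, h3.symm⟩
  obtain ⟨c, rfl⟩ := (SymplecticFrame.mem_plane_point_iff hm p v).1 hv
  obtain ⟨c', rfl⟩ := (SymplecticFrame.mem_plane_point_iff hm p v').1 hv'
  refine ⟨Φ, W, F, m, hm, p, c, c', rfl, h1, h2, (h1.mem_iff _ h2).1 hx, ?_, ?_,
    SymplecticFrame.fderiv_eq_of_metric hm h4⟩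
  · rintro rfl
    exact h0 (Finset.sum_eq_zero fun i _ => zero_smul ℝ _)
  · rintro rfl
    exact h0' (Finset.sum_eq_zero fun i _ => zero_smul ℝ _)

lemma IsLocalEquation.hasFDerivAt {Φ : SymplecticFrame C} {W : Set (M × (Sym2 (Fin n) → ℝ))}
    {F : M × (Sym2 (Fin n) → ℝ) → ℝ} (h : IsLocalEquation Φ E W F) {m : M} {p : Sym2 (Fin n) → ℝ}
    (hW : (m, p) ∈ W) :
    HasFDerivAt (fun p' => F (m, p')) (fderiv ℝ (fun p' => F (m, p')) p) p := by
  have h1 := h.smooth.contMDiffAt (h.isOpen.mem_nhds hW)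
  have h2 : ContMDiffAt 𝓘(ℝ, Sym2 (Fin n) → ℝ) ((𝓡 (2 * n + 1)).prod 𝓘(ℝ, Sym2 (Fin n) → ℝ)) ∞
      (fun p' : Sym2 (Fin n) → ℝ => (m, p')) p := contMDiffAt_const.prodMk contMDiffAt_id
  have h3 : ContMDiffAt 𝓘(ℝ, Sym2 (Fin n) → ℝ) 𝓘(ℝ, ℝ) ∞ (fun p' => F (m, p')) p :=
    ContMDiffAt.comp p (g := F) h1 h2
  exact (h3.contDiffAt.differentiableAt (by simp)).hasFDerivAt

/-- The first part of the theorem: near each of its points the equation coincides with `E_D`. -/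
theorem Fill.exists_isOpen_inter_eq (hD : Fill E ℓ D)
    (hg : ∀ x ∈ E, MetricDecomposes E x (ℓ x) (ℓ' x)) {x : Prolongation C} (hx : x ∈ E) :
    ∃ O : Set (Prolongation C), IsOpen O ∧ x ∈ O ∧ E ∩ O = equationOf C D ∩ O := by
  obtain ⟨Φ, W, F, m, hm, p, c, c', rfl, hloc, hW, hF0, hc, hc', hT⟩ := (hg x hx).exists_chart hx
  obtain ⟨U, V, hU, hmU, hV, hpV, hUV⟩ := mem_nhds_prod_iff'.1 (hloc.isOpen.mem_nhds hW)
  obtain ⟨ρ, hρ, hball⟩ := Metric.isOpen_iff.1 hV p hpV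
  have hsub : U ×ˢ Metric.ball p ρ ⊆ W := (Set.prod_mono le_rfl hball).trans hUV
  have hFc := hloc.smooth.continuousOn.mono hsub
  have hd := hloc.hasFDerivAt hW
  obtain ⟨g, hg1⟩ := exists_symMat_eq_one hc hc'
  -- The filling condition constrains `D` only over the projection of `E`. A sign change of `F` in a
  -- transversal fibre direction shows that this projection is a neighbourhood of `m`.
  have hproj : ∀ᶠ m' in 𝓝 m, m' ∈ Φ.dom ∧ ∃ y ∈ E, y.base = m' := by
    have hTg : fderiv ℝ (fun p' => F (m, p')) p g = 1 := by rw [hT, hg1]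
    obtain ⟨s, hs0, hs1, hs2, hs3, hs4⟩ := (eventually_sign_change hd hF0 hρ (g := -g) (g' := g)
      (by rw [map_neg, hTg]; norm_num) (by rw [hTg]; norm_num)).exists
    have e : (-s) • g = s • (-g) := by rw [neg_smul, smul_neg]
    have hz := eventually_exists_zero hU hFc hmU (p := p) (g := g) (a := -s) (b := s)
      (by linarith) (by rwa [e]) hs4 (by rwa [e]) hs2
    have hcont : Continuous fun m' : M => (m', p) := by fun_prop
    filter_upwards [hcont.continuousAt.eventually hz] with m' hm'
    obtain ⟨τ, -, h1, h2⟩ := hm'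
    exact ⟨hloc.mem_dom _ (hsub h1), _, (hloc.mem_iff _ (hsub h1)).2 h2, rfl⟩
  -- The matrices are chosen point by point, with no continuity; the zero values off the projection
  -- of `E` are irrelevant.
  have hAB : ∀ m' : M, ∃ A B : Matrix (Fin n) (Fin n) ℝ, ∀ hm' : m' ∈ Φ.dom,
      (∃ y ∈ E, y.base = m') → A * A.transpose + B * B.transpose = 1 ∧
      ∀ p', Φ.point m' hm' p' ∈ equationOf C D ↔ (B - A * symMat p').det = 0 := by
    intro m'
    by_cases hm' : m' ∈ Φ.dom ∧ ∃ y ∈ E, y.base = m'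
    · obtain ⟨A, B, h1, h2⟩ := SymplecticFrame.exists_matrices hm'.1
        (hD.le_distribution hg hm'.2) (hD m' hm'.2).1
      exact ⟨A, B, fun _ _ => ⟨h1, fun p' => mem_equationOf_iff.trans (h2 p')⟩⟩
    · exact ⟨0, 0, fun h1 h2 => absurd ⟨h1, h2⟩ hm'⟩
  choose A B hAB using hAB
  have hkey := eventually_eq_zero_of_det hU hρ hFc hmU hF0 hd hc hc' hT (A := A) (B := B)
    (hproj.mono fun m' hm' => (hAB m' hm'.1 hm'.2).1) (by
      intro q hq h0
      have hdom := hloc.mem_dom q (hsub hq)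
      have hqE := (hloc.mem_iff q (hsub hq)).2 h0
      exact ((hAB q.1 hdom ⟨_, hqE, rfl⟩).2 q.2).1
        (mem_equationOf_iff.2 (hD.exists_mem hg hqE)))
  obtain ⟨O, hO, hOo, hmO⟩ := eventually_nhds_iff.1
    (hkey.and ((continuousAt_fst.eventually hproj).and (hloc.isOpen.mem_nhds hW)))
  refine ⟨_, SymplecticFrame.isOpen_image Φ hOo, ⟨(m, p), hmO, hm, rfl⟩, ?_⟩
  ext y
  refine and_congr_left ?_
  rintro ⟨q, hq, hqd, rfl⟩
  obtain ⟨h1, h2, h3⟩ := hO q hq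
  refine ⟨fun hy => mem_equationOf_iff.2 (hD.exists_mem hg hy), fun hy => ?_⟩
  exact (hloc.mem_iff q h3).2 (h1 (((hAB q.1 hqd h2.2).2 q.2).1 hy))

end Filling

end LocalForm

/-! ### Local sections of the equation. -/

section Implicit

/-- The implicit function theorem for one scalar equation, with smoothness on a neighbourhood. -/
lemma exists_implicit {E₁ : Type*} [NormedAddCommGroup E₁] [NormedSpace ℝ E₁] [CompleteSpace E₁]
    {G : E₁ × ℝ → ℝ} {u : E₁ × ℝ} (hG : ∀ᶠ v in 𝓝 u, ContDiffAt ℝ ∞ G v) (h0 : G u = 0)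
    (hd : fderiv ℝ G u (0, 1) ≠ 0) :
    ∃ ψ : E₁ → ℝ, ψ u.1 = u.2 ∧ ∀ᶠ y in 𝓝 u.1, ContDiffAt ℝ ∞ ψ y ∧ G (y, ψ y) = 0 := by
  have hinf : (∞ : ℕ∞ω) ≠ 0 := by simp
  have hinv : ∀ v, fderiv ℝ G v (0, 1) ≠ 0 →
      (fderiv ℝ G v ∘L .inr ℝ E₁ ℝ).IsInvertible := by
    intro v hv
    refine ⟨ContinuousLinearEquiv.unitsEquivAut ℝ (Units.mk0 _ hv), ?_⟩
    ext
    simp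
  have hGu := hG.self_of_nhds
  set ψ := hGu.implicitFunction hinf (hinv u hd) with hψ
  have hψu : ψ u.1 = u.2 := hGu.implicitFunction_apply_self hinf (hinv u hd)
  have hψs : ContDiffAt ℝ ∞ ψ u.1 := hGu.contDiffAt_implicitFunction hinf (hinv u hd)
  have hψ0 : ∀ᶠ y in 𝓝 u.1, G (y, ψ y) = 0 := by
    have := hGu.eventually_apply_implicitFunction hinf (hinv u hd)
    rwa [h0] at this
  have hψc : ∀ᶠ y in 𝓝 u.1, ContinuousAt ψ y :=
    ((hψs.of_le (m := 1) (by simp)).eventually (by simp)).mono fun y hy => hy.continuousAt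
  have hlim : Tendsto (fun y => (y, ψ y)) (𝓝 u.1) (𝓝 u) := by
    have h1 : Tendsto (fun y => (y, ψ y)) (𝓝 u.1) (𝓝 (u.1, ψ u.1)) :=
      (continuousAt_id (x := u.1)).prodMk hψs.continuousAt
    rwa [hψu] at h1
  have hdc : ∀ᶠ v in 𝓝 u, fderiv ℝ G v (0, 1) ≠ 0 := by
    have h1 : ContinuousAt (fun v => fderiv ℝ G v (0, 1)) u :=
      (hGu.continuousAt_fderiv hinf).clm_apply continuousAt_const
    exact h1.eventually (isOpen_ne.mem_nhds hd)
  refine ⟨ψ, hψu, ?_⟩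
  filter_upwards [hψ0, hψ0.eventually_nhds, hψc, hlim.eventually hG, hlim.eventually hdc]
    with y h1 h2 h3 h4 h5
  refine ⟨?_, h1⟩
  -- Smoothness of `ψ` at `u.1` alone does not give order `∞` on a whole neighbourhood. At each
  -- nearby `y`, uniqueness identifies `ψ` with the implicit function constructed there.
  have huniq := h4.eventually_apply_eq_iff_implicitFunction hinf (hinv _ h5)
  have hs := h4.contDiffAt_implicitFunction hinf (hinv _ h5)
  refine hs.congr_of_eventuallyEq ?_
  have hlim' : Tendsto (fun y' => (y', ψ y')) (𝓝 y) (𝓝 (y, ψ y)) :=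
    (continuousAt_id (x := y)).prodMk h3
  filter_upwards [h2, hlim'.eventually huniq] with y' h6 h7
  exact (h7.1 (h6.trans h1.symm)).symm

variable {n : ℕ} {M : Type*} [TopologicalSpace M]
  [ChartedSpace (EuclideanSpace ℝ (Fin (2 * n + 1))) M] [IsManifold (𝓡 (2 * n + 1)) ∞ M]

/-- A local section of a hypersurface `F = 0` which is transversal to the fibres. -/
lemma exists_section {P : Type*} [NormedAddCommGroup P] [NormedSpace ℝ P] {W : Set (M × P)}
    (hW : IsOpen W) {F : M × P → ℝ}
    (hF : ContMDiffOn ((𝓡 (2 * n + 1)).prod 𝓘(ℝ, P)) 𝓘(ℝ, ℝ) ∞ F W) {m₀ : M} {p₀ : P}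
    (hm : (m₀, p₀) ∈ W) (h0 : F (m₀, p₀) = 0) {T : P →L[ℝ] ℝ}
    (hT : HasFDerivAt (fun p => F (m₀, p)) T p₀) {g : P} (hg : T g ≠ 0) :
    ∃ t : M → ℝ, t m₀ = 0 ∧ ∀ᶠ m in 𝓝 m₀,
      ContMDiffAt (𝓡 (2 * n + 1)) 𝓘(ℝ, ℝ) ∞ t m ∧ F (m, p₀ + t m • g) = 0 := by
  set φ := extChartAt (𝓡 (2 * n + 1)) m₀ with hφ
  set σ : EuclideanSpace ℝ (Fin (2 * n + 1)) × ℝ → M × P := fun v => (φ.symm v.1, p₀ + v.2 • g)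
    with hσ
  have hσ0 : σ (φ m₀, 0) = (m₀, p₀) := by
    simp only [hσ, hφ, zero_smul, add_zero, extChartAt_to_inv]
  have htarget : ∀ᶠ v : EuclideanSpace ℝ (Fin (2 * n + 1)) × ℝ in 𝓝 (φ m₀, 0), v.1 ∈ φ.target :=
    (continuous_fst.tendsto' (φ m₀, (0 : ℝ)) (φ m₀) rfl).eventually
      (extChartAt_target_mem_nhds (I := 𝓡 (2 * n + 1)) m₀)
  have hσs : ∀ v : EuclideanSpace ℝ (Fin (2 * n + 1)) × ℝ, v.1 ∈ φ.target →
      ContMDiffAt 𝓘(ℝ, EuclideanSpace ℝ (Fin (2 * n + 1)) × ℝ)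
        ((𝓡 (2 * n + 1)).prod 𝓘(ℝ, P)) ∞ σ v := by
    intro v hv
    have h1 : ContMDiffAt 𝓘(ℝ, EuclideanSpace ℝ (Fin (2 * n + 1))) (𝓡 (2 * n + 1)) ∞ φ.symm v.1 :=
      (contMDiffOn_extChartAt_symm m₀).contMDiffAt
        ((isOpen_extChartAt_target m₀).mem_nhds hv)
    have h2 : ContMDiffAt 𝓘(ℝ, EuclideanSpace ℝ (Fin (2 * n + 1)) × ℝ)
        𝓘(ℝ, EuclideanSpace ℝ (Fin (2 * n + 1))) ∞ Prod.fst v := contDiffAt_fst.contMDiffAt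
    have h3 : ContDiff ℝ ∞ (fun v : EuclideanSpace ℝ (Fin (2 * n + 1)) × ℝ => p₀ + v.2 • g) := by
      fun_prop
    exact (ContMDiffAt.comp v h1 h2).prodMk h3.contMDiff.contMDiffAt
  have hσc : ContinuousAt σ (φ m₀, 0) := (hσs _ (mem_extChartAt_target m₀)).continuousAt
  have hG : ∀ᶠ v in 𝓝 (φ m₀, (0 : ℝ)), ContDiffAt ℝ ∞ (fun v => F (σ v)) v := by
    filter_upwards [htarget, hσc.eventually (hW.mem_nhds (by rwa [hσ0]))] with v h1 h2
    exact (ContMDiffAt.comp v (hF.contMDiffAt (hW.mem_nhds h2)) (hσs v h1)).contDiffAt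
  -- The parameter of `σ` moves along `g` in the fibre, so solvability for it is the condition `T g
  -- ≠ 0`.
  have hd : fderiv ℝ (fun v => F (σ v)) (φ m₀, (0 : ℝ)) (0, 1) = T g := by
    have h1 : HasDerivAt (fun s : ℝ => ((φ m₀, s) : EuclideanSpace ℝ (Fin (2 * n + 1)) × ℝ))
        (0, 1) 0 := (hasDerivAt_const (0 : ℝ) (φ m₀)).prodMk (hasDerivAt_id (0 : ℝ))
    have h2 := (hG.self_of_nhds.differentiableAt (by simp)).hasFDerivAt.comp_hasDerivAt (0 : ℝ) h1
    have h3 : HasDerivAt (fun s : ℝ => p₀ + s • g) g 0 := by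
      simpa using ((hasDerivAt_id (0 : ℝ)).smul_const g).const_add p₀
    have h4 : HasDerivAt (fun s : ℝ => F (m₀, p₀ + s • g)) (T g) 0 :=
      HasFDerivAt.comp_hasDerivAt (0 : ℝ) (l := fun p => F (m₀, p)) (by simpa using hT) h3
    have e : (fun v => F (σ v)) ∘ (fun s : ℝ => (φ m₀, s)) = fun s : ℝ => F (m₀, p₀ + s • g) := by
      funext s
      simp only [Function.comp_apply, hσ, hφ, extChartAt_to_inv]
    rw [e] at h2
    exact h2.unique h4
  obtain ⟨ψ, hψ0, hψ⟩ := exists_implicit hG (by rw [hσ0, h0]) (by rwa [hd])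
  refine ⟨fun m => ψ (φ m), hψ0, ?_⟩
  have hψ' : ∀ᶠ y in 𝓝 (φ m₀), ContDiffAt ℝ ∞ ψ y ∧ F (σ (y, ψ y)) = 0 := hψ
  filter_upwards [(continuousAt_extChartAt (I := 𝓡 (2 * n + 1)) m₀).eventually hψ',
    extChartAt_source_mem_nhds (I := 𝓡 (2 * n + 1)) m₀] with m h1 h2
  have h3 : m ∈ (chartAt (EuclideanSpace ℝ (Fin (2 * n + 1))) m₀).source := by
    rwa [← extChartAt_source (I := 𝓡 (2 * n + 1))]
  refine ⟨ContMDiffAt.comp m h1.1.contMDiffAt (contMDiffAt_extChartAt' h3), ?_⟩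
  have h4 := h1.2
  simp only [hσ, hφ, (extChartAt (𝓡 (2 * n + 1)) m₀).left_inv h2] at h4
  exact h4

end Implicit

/-! ### Smoothness of `D` and the Goursat type. -/

section Smoothness

variable {n : ℕ} {M : Type*} [TopologicalSpace M]
  [ChartedSpace (EuclideanSpace ℝ (Fin (2 * n + 1))) M] [IsManifold (𝓡 (2 * n + 1)) ∞ M]
  {C : (m : M) → Submodule ℝ (TangentSpace (𝓡 (2 * n + 1)) m)}

open Module

lemma IsSmoothFieldAt.add {X Y : (m : M) → TangentSpace (𝓡 (2 * n + 1)) m} {m : M}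
    (hX : IsSmoothFieldAt X m) (hY : IsSmoothFieldAt Y m) :
    IsSmoothFieldAt (fun m => X m + Y m) m :=
  ContMDiffAt.add_section hX hY

lemma IsSmoothFieldAt.smul {X : (m : M) → TangentSpace (𝓡 (2 * n + 1)) m} {m : M} {f : M → ℝ}
    (hf : ContMDiffAt (𝓡 (2 * n + 1)) 𝓘(ℝ, ℝ) ∞ f m) (hX : IsSmoothFieldAt X m) :
    IsSmoothFieldAt (fun m => f m • X m) m :=
  ContMDiffAt.smul_section hf hX

lemma IsSmoothFieldAt.sum {ι : Type*} [Fintype ι]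
    {X : ι → (m : M) → TangentSpace (𝓡 (2 * n + 1)) m} {m : M}
    (hX : ∀ i, IsSmoothFieldAt (X i) m) : IsSmoothFieldAt (fun m => ∑ i, X i m) m :=
  ContMDiffAt.sum_section fun i _ => hX i

variable {E : Set (Prolongation C)}
  {ℓ ℓ' : (x : Prolongation C) → Submodule ℝ (TangentSpace (𝓡 (2 * n + 1)) x.base)}
  {D : (m : M) → Submodule ℝ (TangentSpace (𝓡 (2 * n + 1)) m)}

/-- Every vector of a line `ℓ_x` extends to a smooth section of `D`. -/
lemma Fill.exists_field (hD : Fill E ℓ D) (hg : ∀ x ∈ E, MetricDecomposes E x (ℓ x) (ℓ' x))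
    (hℓ : IsSmoothLineField E ℓ) {x : Prolongation C} (hx : x ∈ E)
    {u : TangentSpace (𝓡 (2 * n + 1)) x.base} (hu : u ∈ ℓ x) :
    ∃ X : (m : M) → TangentSpace (𝓡 (2 * n + 1)) m, X x.base = u ∧ ∀ᶠ m in 𝓝 x.base,
      IsSmoothFieldAt X m ∧ X m ∈ D m ∧ ∃ y ∈ E, y.base = m := by
  obtain ⟨Φ, W, F, m₀, hm₀, p, c, c', rfl, hloc, hW, hF0, hc, hc', hT⟩ := (hg x hx).exists_chart hx
  obtain ⟨Φ', W', a, h', p', hW'o, hW', hpt, has, ha⟩ := hℓ _ hx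
  change m₀ ∈ Φ'.dom at h'
  change (m₀, p') ∈ W' at hW'
  change TangentSpace (𝓡 (2 * n + 1)) m₀ at u
  obtain ⟨hdet, htr⟩ := SymplecticFrame.trans_of_point_eq h' hm₀ hpt
  obtain ⟨g, hg1⟩ := exists_symMat_eq_one hc hc'
  obtain ⟨t, ht0, ht⟩ := exists_section hloc.isOpen hloc.smooth hW hF0 (hloc.hasFDerivAt hW)
    (g := g) (by rw [hT, hg1]; exact one_ne_zero)
  have ht₀ := ht.self_of_nhds.1
  set s : M → M × (Sym2 (Fin n) → ℝ) := fun m => (m, p + t m • g) with hs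
  have hs0 : s m₀ = (m₀, p) := by simp only [hs, ht0, zero_smul, add_zero]
  have hss : ∀ m, ContMDiffAt (𝓡 (2 * n + 1)) 𝓘(ℝ, ℝ) ∞ t m → ContMDiffAt (𝓡 (2 * n + 1))
      ((𝓡 (2 * n + 1)).prod 𝓘(ℝ, Sym2 (Fin n) → ℝ)) ∞ s m := by
    intro m hm
    have h1 : ContDiff ℝ ∞ (fun τ : ℝ => p + τ • g) := by fun_prop
    exact contMDiffAt_id.prodMk
      (ContMDiffAt.comp m (g := fun τ : ℝ => p + τ • g) h1.contMDiff.contMDiffAt hm)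
  have hsc : Tendsto s (𝓝 m₀) (𝓝 (m₀, p)) := by
    have := (hss m₀ ht₀).continuousAt
    unfold ContinuousAt at this
    rwa [hs0] at this
  -- The metric and the line field may come with different frames; `r` is the section `s` in the
  -- coordinates of `Φ'`, where the spanning vector of `ℓ` has smooth coefficients.
  set r : M → M × (Sym2 (Fin n) → ℝ) := fun m => (m, Φ'.trans Φ (s m)) with hr
  have hr0 : r m₀ = (m₀, p') := by simp only [hr, hs0, htr]
  have hrs : ∀ m, m ∈ Φ'.dom → m ∈ Φ.dom → (Φ'.transE Φ (s m)).det ≠ 0 →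
      ContMDiffAt (𝓡 (2 * n + 1)) 𝓘(ℝ, ℝ) ∞ t m → ContMDiffAt (𝓡 (2 * n + 1))
      ((𝓡 (2 * n + 1)).prod 𝓘(ℝ, Sym2 (Fin n) → ℝ)) ∞ r m := by
    intro m h1 h2 h3 h4
    exact contMDiffAt_id.prodMk
      (ContMDiffAt.comp m (g := Φ'.trans Φ) (SymplecticFrame.contMDiffAt_trans h1 h2 h3) (hss m h4))
  have hrc : Tendsto r (𝓝 m₀) (𝓝 (m₀, p')) := by
    have := (hrs m₀ h' hm₀ (by rwa [hs0]) ht₀).continuousAt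
    unfold ContinuousAt at this
    rwa [hr0] at this
  set X : (m : M) → TangentSpace (𝓡 (2 * n + 1)) m := fun m => ∑ i, a i (r m) • Φ'.w m (r m).2 i
    with hX
  have hXs : ∀ m, m ∈ Φ'.dom → r m ∈ W' → ContMDiffAt (𝓡 (2 * n + 1))
      ((𝓡 (2 * n + 1)).prod 𝓘(ℝ, Sym2 (Fin n) → ℝ)) ∞ r m → IsSmoothFieldAt X m := by
    intro m h1 h2 h3
    have h4 : ∀ k, ContMDiffAt (𝓡 (2 * n + 1)) 𝓘(ℝ, ℝ) ∞ (fun m => (r m).2 k) m := fun k =>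
      contMDiffAt_pi_space.1 (contMDiffAt_snd.comp m h3) k
    refine IsSmoothFieldAt.sum fun i => IsSmoothFieldAt.smul
      (ContMDiffAt.comp m (g := a i) ((has i).contMDiffAt (hW'o.mem_nhds h2)) h3) ?_
    exact ((Φ'.smooth_e i).at Φ'.contactForm.isOpen h1).add <| IsSmoothFieldAt.sum fun j =>
      IsSmoothFieldAt.smul (h4 s(i, j)) ((Φ'.smooth_f j).at Φ'.contactForm.isOpen h1)
  obtain ⟨μ, hμ⟩ : ∃ μ : ℝ, μ • X m₀ = u := by
    -- The space containing `ℓ y` depends on `y`, so the point is generalised before rewriting and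
    -- the conclusion is a heterogeneous equality.
    have key : ∀ y, y = Φ'.point m₀ h' p' → ∀ v : TangentSpace (𝓡 (2 * n + 1)) y.base, v ∈ ℓ y →
        ∃ μ : ℝ, HEq (μ • X m₀) v := by
      rintro _ rfl v hv
      have hpE : Φ'.point m₀ h' p' ∈ E := by
        have e : Φ'.point m₀ h' p' = Φ.point m₀ hm₀ p := hpt
        rw [e]; exact hx
      rw [(ha (m₀, p') hW' h' hpE).2] at hv
      obtain ⟨μ, rfl⟩ := (Submodule.mem_span_singleton (R := ℝ)
        (M := TangentSpace (𝓡 (2 * n + 1)) m₀)).1 hv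
      refine ⟨μ, heq_of_eq ?_⟩
      simp only [hX, hr0]
    obtain ⟨μ, hμ⟩ := key _ hpt.symm u hu
    exact ⟨μ, eq_of_heq hμ⟩
  refine ⟨fun m => μ • X m, hμ, ?_⟩
  change ∀ᶠ m in 𝓝 m₀, _
  filter_upwards [ht, Φ.contactForm.isOpen.mem_nhds hm₀, Φ'.contactForm.isOpen.mem_nhds h',
    hsc.eventually (SymplecticFrame.eventually_transE_ne_zero h' hm₀ hdet),
    hsc.eventually (hloc.isOpen.mem_nhds hW), hrc.eventually (hW'o.mem_nhds hW')]
    with m h1 h2 h3 h4 h5 h6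
  have hE : Φ'.point m h3 (r m).2 ∈ E := by
    have hpt' : Φ'.point m h3 (r m).2 = Φ.point m h2 (s m).2 := SymplecticFrame.point_trans h3 h2 h4
    rw [hpt']
    exact (hloc.mem_iff _ h5).2 h1.2
  refine ⟨IsSmoothFieldAt.smul contMDiffAt_const (hXs m h3 h6 (hrs m h3 h2 h4 h1.1)), ?_,
    _, hE, rfl⟩
  refine Submodule.smul_mem _ _ ?_
  have hl := hD.line_le hE
  rw [(ha (r m) h6 h3 hE).2] at hl
  have hself : X m ∈ Submodule.span ℝ {X m} := Submodule.mem_span_singleton_self _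
  exact hl hself

/-- The second part of the theorem: `D` is smooth if `ℓ` is. -/
theorem Fill.isSubdistributionOn (hD : Fill E ℓ D)
    (hg : ∀ x ∈ E, MetricDecomposes E x (ℓ x) (ℓ' x)) (hℓ : IsSmoothLineField E ℓ) :
    IsSubdistributionOn C D {m | ∃ x ∈ E, x.base = m} := by
  intro m₀ hm₀
  obtain ⟨hfin, hspan⟩ := hD m₀ hm₀
  obtain ⟨b, hb, hbi⟩ : ∃ b : Fin n → TangentSpace (𝓡 (2 * n + 1)) m₀,
      (∀ i, b i ∈ {v | ∃ x ∈ E, ∃ u ∈ ℓ x,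
        (⟨m₀, v⟩ : TangentBundle (𝓡 (2 * n + 1)) M) = ⟨x.base, u⟩}) ∧ LinearIndependent ℝ b := by
    -- Since the lines span `D m₀`, a basis of it can be extracted from their vectors alone, and
    -- these extend to sections of `D`.
    obtain ⟨f, hf, -, hfi⟩ := Submodule.exists_fun_fin_finrank_span_eq ℝ
      {v : TangentSpace (𝓡 (2 * n + 1)) m₀ | ∃ x ∈ E, ∃ u ∈ ℓ x,
        (⟨m₀, v⟩ : TangentBundle (𝓡 (2 * n + 1)) M) = ⟨x.base, u⟩}
    rw [hspan] at hfin
    exact ⟨f ∘ (finCongr hfin).symm, fun i => hf _, hfi.comp _ (finCongr hfin).symm.injective⟩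
  have hX : ∀ i, ∃ X : (m : M) → TangentSpace (𝓡 (2 * n + 1)) m, X m₀ = b i ∧ ∀ᶠ m in 𝓝 m₀,
      IsSmoothFieldAt X m ∧ X m ∈ D m ∧ ∃ y ∈ E, y.base = m := by
    intro i
    obtain ⟨x, hx, u, hu, heq⟩ := hb i
    generalize b i = v at heq
    cases heq
    exact hD.exists_field hg hℓ hx hu
  choose X hX0 hX using hX
  have hbX : (fun i => X i m₀) = b := funext hX0
  have hind := eventually_linearIndependent (fun i => (hX i).self_of_nhds.1)
    (show LinearIndependent ℝ fun i => X i m₀ by rwa [hbX])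
  -- Extending the zero vector suffices; the family `X` would give nothing if `Fin n` were empty.
  have hE : ∀ᶠ m in 𝓝 m₀, ∃ y ∈ E, y.base = m := by
    obtain ⟨x, hx, rfl⟩ := hm₀
    obtain ⟨v, -, v', -, -, -, hl, -⟩ := hg x hx
    obtain ⟨Y, -, hY⟩ := hD.exists_field hg hℓ hx (zero_mem (ℓ x))
    exact hY.mono fun m hm => hm.2.2
  obtain ⟨V, hV, hVo, hmV⟩ := eventually_nhds_iff.1 (hind.and (hE.and (eventually_all.2 hX)))
  refine ⟨V, hVo, hmV, fun m hm => (hV m hm).2.1, X, fun i m hm =>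
    ((hV m hm).2.2 i).1.contMDiffWithinAt, fun m hm => ⟨(hV m hm).1, ?_,
      hD.le_distribution hg (hV m hm).2.1⟩⟩
  -- The `n` independent fields take values in `D`, whose dimension is `n` at every point over the
  -- projection of `E`.
  refine (Submodule.eq_of_le_of_finrank_eq (Submodule.span_le.2 ?_) ?_).symm
  · rintro _ ⟨i, rfl⟩
    exact ((hV m hm).2.2 i).2.1
  · rw [finrank_span_eq_card (hV m hm).1, Fintype.card_fin, (hD m (hV m hm).2.1).1]

lemma isOpen_base_preimage {U : Set M} (hU : IsOpen U) : IsOpen {y : Prolongation C | y.base ∈ U} := by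
  intro Φ
  convert (Φ.contactForm.isOpen.inter hU).preimage
    (continuous_fst : Continuous (Prod.fst : M × (Sym2 (Fin n) → ℝ) → M)) using 1
  ext q
  exact ⟨fun ⟨h1, h2⟩ => ⟨h1, h2⟩, fun h => ⟨h.1, h.2⟩⟩

lemma IsSubdistributionOn.isOpen {U : Set M} (h : IsSubdistributionOn C D U) : IsOpen U := by
  rw [isOpen_iff_mem_nhds]
  intro m hm
  obtain ⟨V, hV, hmV, hVU, -⟩ := h m hm
  exact mem_of_superset (hV.mem_nhds hmV) hVU

theorem Fill.isGoursatType (hD : Fill E ℓ D)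
    (hg : ∀ x ∈ E, MetricDecomposes E x (ℓ x) (ℓ' x)) (hℓ : IsSmoothLineField E ℓ) :
    IsGoursatType E := by
  intro x hx
  have hS := hD.isSubdistributionOn hg hℓ
  obtain ⟨O, hO, hxO, hEO⟩ := hD.exists_isOpen_inter_eq hg hx
  refine ⟨D, _, O ∩ {y | y.base ∈ {m | ∃ x ∈ E, x.base = m}}, hS,
    hO.inter (isOpen_base_preimage hS.isOpen), ⟨hxO, x, hx, rfl⟩, fun y hy => hy.2, ?_⟩
  rw [← Set.inter_assoc, ← Set.inter_assoc, hEO]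

end Smoothness

end ContactPDE

end

theorem mainTheorem3 {n : ℕ} {M : Type*} [TopologicalSpace M]
    [ChartedSpace (EuclideanSpace ℝ (Fin (2 * n + 1))) M] [IsManifold (𝓡 (2 * n + 1)) ∞ M]
    (C : (m : M) → Submodule ℝ (TangentSpace (𝓡 (2 * n + 1)) m))
    (hC : ContactPDE.IsContactStructure C)
    (E : Set (ContactPDE.Prolongation C)) (hE : ContactPDE.IsHypersurface E)
    (ℓ ℓ' : (x : ContactPDE.Prolongation C) →
      Submodule ℝ (TangentSpace (𝓡 (2 * n + 1)) x.base))
    (hg : ∀ x ∈ E, ContactPDE.MetricDecomposes E x (ℓ x) (ℓ' x))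
    (D₁ D₂ : (m : M) → Submodule ℝ (TangentSpace (𝓡 (2 * n + 1)) m))
    (hD₁ : ContactPDE.Fill E ℓ D₁) (hD₂ : ContactPDE.Fill E ℓ' D₂) :
    (∀ x ∈ E, ∃ O : Set (ContactPDE.Prolongation C), IsOpen O ∧ x ∈ O ∧
      E ∩ O = ContactPDE.equationOf C D₁ ∩ O ∧ E ∩ O = ContactPDE.equationOf C D₂ ∩ O) ∧
    (ContactPDE.IsSmoothLineField E ℓ →
      ContactPDE.IsSubdistributionOn C D₁ {m | ∃ x ∈ E, x.base = m}) ∧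
    (ContactPDE.IsSmoothLineField E ℓ' →
      ContactPDE.IsSubdistributionOn C D₂ {m | ∃ x ∈ E, x.base = m}) ∧
    (ContactPDE.IsSmoothLineField E ℓ ∨ ContactPDE.IsSmoothLineField E ℓ' →
      ContactPDE.IsGoursatType E) := by
  -- The symmetric product commutes, so every statement about `D₂` is the one about `D₁` with the
  -- lines exchanged.
  have hg' : ∀ x ∈ E, ContactPDE.MetricDecomposes E x (ℓ' x) (ℓ x) := fun x hx => (hg x hx).symm
  refine ⟨fun x hx => ?_, hD₁.isSubdistributionOn hg, hD₂.isSubdistributionOn hg', ?_⟩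
  · obtain ⟨O₁, hO₁, hx₁, h₁⟩ := hD₁.exists_isOpen_inter_eq hg hx
    obtain ⟨O₂, hO₂, hx₂, h₂⟩ := hD₂.exists_isOpen_inter_eq hg' hx
    refine ⟨O₁ ∩ O₂, hO₁.inter hO₂, ⟨hx₁, hx₂⟩, ?_, ?_⟩
    · rw [← Set.inter_assoc, ← Set.inter_assoc, h₁]
    · rw [Set.inter_comm O₁, ← Set.inter_assoc, ← Set.inter_assoc, h₂]
  · rintro (h | h)
    · exact hD₁.isGoursatType hg h
    · exact hD₂.isGoursatType hg' h
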